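/- A source multicasts an ordered infinite stream of packets $s_0,s_1,s_2,\dots$ to two users $U_1,U_2$ over independent, memoryless erasure channels: in each slot the source sends one linear combination of packets over a finite field $F$, and $U_i$ receives it with probability $p_i\in(0,1]$, independently over users and slots. Before each slot the source knows all past erasures. A coding scheme chooses each transmission as a function of the past erasures, and possibly of internal randomness that is independent of the channels. A user has decoded $s_j$ if $s_j$ lies in the span of the combinations it has received. Let $r_i(n)$ be the index of the required packet of $U_i$, i.e. its earliest undecoded packet after $n$ slots, and write $r_i$ for its current value. For the two user problem we consider the schemes that in every slot send a linear combination of the two required packets, $\alpha s_{r_1}+\beta s_{r_2}$ with $\alpha,\beta\in F$ (for example $s_{r_1}$, $s_{r_2}$ or $s_{r_1}\oplus s_{r_2}$). Let $X_{i,n}$ be the number of unerased slots of $U_i$ among the first $n$, and let $Y_{i,n}$ be the number of these in which the received combination is not innovative, i.e. already lies in the span of the combinations that $U_i$ received before. The throughput loss is $\delta_i=\lim_{n\to\infty} Y_{i,n}/X_{i,n}$ and the smoothness index is $$\sigma_i=\lim_{n\to\infty}\frac1n\sum_{k=1}^n \mathbf 1\big(r_i(k)>r_i(k-1)\big),$$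 both limits in probability, when they exist. A scheme is throughput-optimal for both users if $\delta_1=\delta_2=0$. Let $r_{\max}=\max(r_1,r_2)$ and $r_{\min}=\min(r_1,r_2)$. If $r_1\ne r_2$, the user with the larger $r_i$ is the leader and the other one is the lagger. The greedy scheme sends $s_{r_{\max}}\oplus s_{r_{\min}}$ (the sum over $F$) when the lagger has decoded $s_{r_{\max}}$ but the leader has not, and sends $s_{r_{\max}}$ otherwise. Claim. The greedy scheme belongs to the class above and is throughput-optimal for both users. If $p_1\neq p_2$, then its smoothness indices $\sigma_1,\sigma_2$ exist, and for every scheme in the class that is throughput-optimal for both users and for each $i$, if that scheme has a smoothness index $\sigma_i'$, then $\sigma_i'\le\sigma_i$. -/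

import Mathlib

open MeasureTheory ProbabilityTheory Filter

namespace InOrder

/-- A linear combination of the source packets, given by its coefficients over the field `F`.
Packets are numbered `0, 1, 2, …`. -/
abbrev Comb (F : Type*) [Field F] := ℕ →₀ F

/-- The uncoded packet with index `j`. -/
noncomputable def packet (F : Type*) [Field F] (j : ℕ) : Comb F := Finsupp.single j 1

/-- Which of the two users receive the transmission of a slot (`true`: received,
`false`: erased). -/
abbrev Pattern := Fin 2 → Bool

/-- A coding scheme with instantaneous feedback: the combination to transmit in the next slot, as
a function of the reception patterns of all earlier slots (most recent slot first). -/
abbrev Scheme (F : Type*) [Field F] := List Pattern → Comb F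

/-- The combinations a user can compute after a slot: those it could compute before, together with
the transmitted combination if it was received. -/
noncomputable def receive {F : Type*} [Field F] (V : Submodule F (Comb F)) (ok : Bool)
    (y : Comb F) : Submodule F (Comb F) :=
  if ok = true then V ⊔ Submodule.span F {y} else V

/-- The span of everything that user `i` has received under the scheme `C`, after the slots whose
reception patterns are listed. -/
noncomputable def knowledge {F : Type*} [Field F] (C : Scheme F) :
    List Pattern → Fin 2 → Submodule F (Comb F)
  | [], _ => ⊥
  | x :: h, i => receive (knowledge C h i) (x i) (C h)

/-- A user who knows `V` has decoded packet `j`. -/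
def Decoded {F : Type*} [Field F] (V : Submodule F (Comb F)) (j : ℕ) : Prop := packet F j ∈ V

/-- The index of the required packet: the earliest packet that is not decoded. -/
noncomputable def required {F : Type*} [Field F] (V : Submodule F (Comb F)) : ℕ :=
  sInf {j | ¬ Decoded V j}

/-- At any time some packet is undecoded, so that `required` is a genuine minimum. -/
theorem exists_not_decoded {F : Type*} [Field F] (C : Scheme F) (h : List Pattern) (i : Fin 2) :
    ∃ j, ¬ Decoded (knowledge C h i) j := by
  have hfin : ∀ h : List Pattern, (knowledge C h i).FG := by
    intro h
    induction h with
    | nil => exact Submodule.fg_bot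
    | cons x h ih =>
      simp only [knowledge, receive]
      split_ifs
      · exact ih.sup (Submodule.fg_span_singleton _)
      · exact ih
  by_contra hall
  push Not at hall
  have htop : knowledge C h i = ⊤ := by
    refine eq_top_iff.mpr fun v _ => ?_
    induction v using Finsupp.induction_linear with
    | zero => exact Submodule.zero_mem _
    | add u v hu hv => exact Submodule.add_mem _ (hu trivial) (hv trivial)
    | single j c =>
      have hj : packet F j ∈ knowledge C h i := hall j
      simpa [packet] using Submodule.smul_mem _ c hj
  have hF : Module.Finite F (ℕ →₀ F) := ⟨htop ▸ hfin h⟩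
  have hN : Finite ℕ := Module.Finite.finite_basis (Finsupp.basisSingleOne (R := F) (ι := ℕ))
  exact not_finite ℕ

open Classical in
/-- The greedy choice of the transmitted combination, given what the two users know: if there is a
lagger who has decoded the leader's required packet while the leader has not, transmit the sum of
the two required packets; otherwise transmit the leader's required packet. -/
noncomputable def greedyRule {F : Type*} [Field F] (V : Fin 2 → Submodule F (Comb F)) : Comb F :=
  let r : Fin 2 → ℕ := fun i => required (V i)
  let rmax := max (r 0) (r 1)
  let rmin := min (r 0) (r 1)
  if ∃ lag lead : Fin 2, r lag < r lead ∧ Decoded (V lag) rmax ∧ ¬ Decoded (V lead) rmax then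
    packet F rmax + packet F rmin
  else packet F rmax

/-- What the users know when the source follows the greedy rule. -/
noncomputable def greedyKnowledge (F : Type*) [Field F] :
    List Pattern → Fin 2 → Submodule F (Comb F)
  | [], _ => ⊥
  | x :: h, i => receive (greedyKnowledge F h i) (x i) (greedyRule (greedyKnowledge F h))

/-- The greedy coding scheme. -/
noncomputable def greedy (F : Type*) [Field F] : Scheme F :=
  fun h => greedyRule (greedyKnowledge F h)

theorem knowledge_greedy (F : Type*) [Field F] (h : List Pattern) :
    knowledge (greedy F) h = greedyKnowledge F h := by
  induction h with
  | nil => rfl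
  | cons x h ih => funext i; simp only [knowledge, greedyKnowledge, ih, greedy]

/-- The greedy scheme applies the greedy rule to the users' actual knowledge in every slot. -/
theorem greedy_apply (F : Type*) [Field F] (h : List Pattern) :
    greedy F h = greedyRule (knowledge (greedy F) h) := by
  rw [knowledge_greedy, greedy]

/-- In every slot the scheme transmits a linear combination of the current required packets of the
two users (in particular, possibly one of these packets or their sum). -/
def UsesRequiredPackets {F : Type*} [Field F] (C : Scheme F) : Prop :=
  ∀ h : List Pattern, ∃ α β : F,
    C h = α • packet F (required (knowledge C h 0)) + β • packet F (required (knowledge C h 1))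

/-- `R i n` tells whether user `i` receives the transmission of slot `n + 1`: the events are
independent over users and slots, and have probability `p i`. -/
structure IsErasureChannel {Ω : Type*} [MeasurableSpace Ω] (μ : Measure Ω) (p : Fin 2 → ℝ)
    (R : Fin 2 → ℕ → Ω → Bool) : Prop where
  measurable : ∀ i n, Measurable (R i n)
  indep : iIndepFun (fun (k : Fin 2 × ℕ) => R k.1 k.2) μ
  prob : ∀ i n, μ.real {ω | R i n ω = true} = p i

/-- The reception patterns of the first `n` slots, most recent slot first. -/
def history {Ω : Type*} (R : Fin 2 → ℕ → Ω → Bool) : ℕ → Ω → List Pattern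
  | 0, _ => []
  | n + 1, ω => (fun i => R i n ω) :: history R n ω

/-- A (possibly randomized) scheme `C ω` is admissible if it is chosen measurably, and its internal
randomness is independent of the channel. A constant `C` is a deterministic scheme. -/
structure IsAdmissible {F : Type*} [Field F] {Ω : Type*} [MeasurableSpace Ω] (μ : Measure Ω)
    (R : Fin 2 → ℕ → Ω → Bool) (C : Ω → Scheme F) : Prop where
  measurable : ∀ h : List Pattern, Measurable[_, ⊤] (fun ω => C ω h)
  indep : Indep (⨆ h : List Pattern, MeasurableSpace.comap (fun ω => C ω h) ⊤)
    (⨆ k : Fin 2 × ℕ, MeasurableSpace.comap (R k.1 k.2) ⊤) μ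

section Metrics

/-- What user `i` knows after `n` slots. -/
noncomputable def knows {F : Type*} [Field F] {Ω : Type*} (R : Fin 2 → ℕ → Ω → Bool)
    (C : Ω → Scheme F) (i : Fin 2) (n : ℕ) (ω : Ω) : Submodule F (Comb F) :=
  knowledge (C ω) (history R n ω) i

/-- The combination that is transmitted in slot `n + 1`. -/
noncomputable def sent {F : Type*} [Field F] {Ω : Type*} (R : Fin 2 → ℕ → Ω → Bool)
    (C : Ω → Scheme F) (n : ℕ) (ω : Ω) : Comb F :=
  C ω (history R n ω)

/-- The index of the required packet of user `i` after `n` slots. -/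
noncomputable def requiredAt {F : Type*} [Field F] {Ω : Type*} (R : Fin 2 → ℕ → Ω → Bool)
    (C : Ω → Scheme F) (i : Fin 2) (n : ℕ) (ω : Ω) : ℕ :=
  required (knows R C i n ω)

/-- The number of unerased slots for user `i` among the first `n`. -/
def received {Ω : Type*} (R : Fin 2 → ℕ → Ω → Bool) (i : Fin 2) (n : ℕ) (ω : Ω) : ℕ :=
  ((Finset.range n).filter (fun k => R i k ω = true)).card

open Classical in
/-- The number of slots among the first `n` in which user `i` receives a combination that is not
innovative, that is, one that it can already compute. -/
noncomputable def redundant {F : Type*} [Field F] {Ω : Type*} (R : Fin 2 → ℕ → Ω → Bool)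
    (C : Ω → Scheme F) (i : Fin 2) (n : ℕ) (ω : Ω) : ℕ :=
  ((Finset.range n).filter
    (fun k => R i k ω = true ∧ sent R C k ω ∈ knows R C i k ω)).card

open Classical in
/-- The number of slots among the first `n` in which a burst of in-order packets is delivered to
user `i`. -/
noncomputable def bursts {F : Type*} [Field F] {Ω : Type*} (R : Fin 2 → ℕ → Ω → Bool)
    (C : Ω → Scheme F) (i : Fin 2) (n : ℕ) (ω : Ω) : ℕ :=
  ((Finset.range n).filter
    (fun k => requiredAt R C i k ω < requiredAt R C i (k + 1) ω)).card

/-- The throughput loss of user `i` exists and equals `δ`. -/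
def HasThroughputLoss {F : Type*} [Field F] {Ω : Type*} [MeasurableSpace Ω] (μ : Measure Ω)
    (R : Fin 2 → ℕ → Ω → Bool) (C : Ω → Scheme F) (i : Fin 2) (δ : ℝ) : Prop :=
  TendstoInMeasure μ (fun (n : ℕ) (ω : Ω) => (redundant R C i n ω : ℝ) / (received R i n ω : ℝ))
    atTop (fun _ => δ)

/-- The smoothness index of user `i` exists and equals `s`. -/
def HasSmoothnessIndex {F : Type*} [Field F] {Ω : Type*} [MeasurableSpace Ω] (μ : Measure Ω)
    (R : Fin 2 → ℕ → Ω → Bool) (C : Ω → Scheme F) (i : Fin 2) (s : ℝ) : Prop :=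
  TendstoInMeasure μ (fun (n : ℕ) (ω : Ω) => (bursts R C i n ω : ℝ) / (n : ℝ))
    atTop (fun _ => s)

/-- Throughput optimality to both users: neither has any throughput loss. -/
def ThroughputOptimal {F : Type*} [Field F] {Ω : Type*} [MeasurableSpace Ω] (μ : Measure Ω)
    (R : Fin 2 → ℕ → Ω → Bool) (C : Ω → Scheme F) : Prop :=
  ∀ i, HasThroughputLoss μ R C i 0

end Metrics

end InOrder

set_option linter.unusedSectionVars false

/-! Let `a` be the user with the larger reception probability and `b` the other one. The proof
compares the bursts of `b` with a process that depends on the channel alone.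

Under a scheme of the class nothing beyond the leader's required packet has ever been sent, so a
leader knows exactly the packets before its required one (`UsesRequiredPackets.leader_eq`). Call a
slot regular if `a` leads and the transmission is innovative for `a`; the transmission then has a
nonzero coefficient at the required packet of `a`. If `a` receives it, `a` advances by one and `b`
knows nothing beyond the prefix of `a`; if only `b` receives it, `b` gets ahead. A burst of `b` in a
regular slot requires that `b` is ahead. Thus in regular slots `Ahead` obeys the recursion of
`LastOnly`, and the bursts of `b` are at most the slots with `LastOnly` in which `b` receives, up to
twice the irregular slots (`bursts_le_slots`). For greedy the reverse comparison holds too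
(`slots_le_bursts_greedy`), because what a user knows is spanned by packets, so that being ahead
means having the leader's packet.

Irregular slots are rare (`exists_slots_not_regular_le`). When `b` is not behind, counting
dimensions shows that `a` has received at most one packet more than `b`, up to the redundant
receptions of `a`; by the strong law the difference in receptions grows linearly. The slots that are
not innovative for `a` have vanishing frequency if `a` has no throughput loss, since reception is
independent of the transmission (`redundant_law`).

The frequency of the comparison process is `lagRate` (`lastOnly_law`). For `a` itself, bursts are
bounded by receptions, and greedy attains the resulting bound `p a`. -/

namespace InOrder

/-! ### Linear algebra of the users' knowledge: leader, lagger and getting ahead -/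

section Algebra

variable {F : Type*} [Field F]

/-- The combinations of the packets with index below `m`. -/
noncomputable def low (F : Type*) [Field F] (m : ℕ) : Submodule F (Comb F) :=
  Finsupp.supported F F (Set.Iio m)

lemma mem_low {m : ℕ} {v : Comb F} : v ∈ low F m ↔ ∀ j, m ≤ j → v j = 0 := by
  simp [low, Finsupp.mem_supported']

lemma packet_mem_low {j m : ℕ} : packet F j ∈ low F m ↔ j < m := by
  rw [mem_low]
  constructor
  · intro h
    by_contra hj
    simpa [packet] using h j (not_lt.1 hj)
  · intro h k hk
    exact Finsupp.single_eq_of_ne (by omega)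

lemma low_le_iff {m : ℕ} {V : Submodule F (Comb F)} :
    low F m ≤ V ↔ ∀ j < m, packet F j ∈ V := by
  rw [low, Finsupp.supported_eq_span_single, Submodule.span_le]
  simp [Set.subset_def, packet]

instance finiteDimensional_low (m : ℕ) : FiniteDimensional F (low F m) :=
  Module.Finite.equiv (Finsupp.supportedEquivFinsupp (M := F) (R := F) (Set.Iio m)).symm

lemma finrank_low (m : ℕ) : Module.finrank F (low F m) = m := by
  rw [low, (Finsupp.supportedEquivFinsupp (M := F) (R := F) (Set.Iio m)).finrank_eq]
  simp

lemma decoded_of_lt_required {V : Submodule F (Comb F)} {j : ℕ} (h : j < required V) :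
    packet F j ∈ V := by
  by_contra hj
  exact Nat.notMem_of_lt_sInf h hj

lemma low_required_le (V : Submodule F (Comb F)) : low F (required V) ≤ V :=
  low_le_iff.2 fun _ h => decoded_of_lt_required h

lemma required_le {V : Submodule F (Comb F)} {j : ℕ} (h : packet F j ∉ V) : required V ≤ j :=
  Nat.sInf_le h

lemma packet_required_notMem {V : Submodule F (Comb F)} (hV : ∃ j, ¬ Decoded V j) :
    packet F (required V) ∉ V :=
  Nat.sInf_mem (s := {j | ¬ Decoded V j}) hV

lemma required_mono {V W : Submodule F (Comb F)} (h : V ≤ W) (hW : ∃ j, ¬ Decoded W j) :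
    required V ≤ required W :=
  required_le fun hV => packet_required_notMem hW (h hV)

lemma required_lt {V W : Submodule F (Comb F)} (h : V ≤ W) (hW : ∃ j, ¬ Decoded W j)
    (hp : packet F (required V) ∈ W) : required V < required W :=
  lt_of_le_of_ne (required_mono h hW) fun e => packet_required_notMem hW (e ▸ hp)

/-- A known vector with a nonzero coefficient at the required index would reveal the required
packet, since its lower terms are already known. -/
lemma eq_low_required {V : Submodule F (Comb F)} (hV : ∃ j, ¬ Decoded V j)
    (h : V ≤ low F (required V + 1)) : V = low F (required V) := by
  refine le_antisymm (fun v hv => ?_) (low_required_le V)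
  set r := required V
  have hsub : v - v r • packet F r ∈ low F r := by
    rw [mem_low]
    intro j hj
    rcases hj.eq_or_lt with rfl | hj
    · simp [packet]
    · have := mem_low.1 (h hv) j hj
      simp [packet, this, hj.ne]
  have hmem : v r • packet F r ∈ V := by
    have := V.sub_mem hv (low_required_le V hsub)
    simpa using this
  by_cases h0 : v r = 0
  · simpa [h0] using hsub
  · exact absurd ((V.smul_mem_iff h0).1 hmem) (packet_required_notMem hV)

lemma receive_true (V : Submodule F (Comb F)) (y : Comb F) :
    receive V true y = V ⊔ Submodule.span F {y} := rfl

lemma receive_false (V : Submodule F (Comb F)) (y : Comb F) : receive V false y = V := rfl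

lemma le_receive (V : Submodule F (Comb F)) (ok : Bool) (y : Comb F) : V ≤ receive V ok y := by
  cases ok
  · exact le_rfl
  · exact le_sup_left

lemma receive_le {V W : Submodule F (Comb F)} {ok : Bool} {y : Comb F} (hV : V ≤ W)
    (hy : y ∈ W) : receive V ok y ≤ W := by
  cases ok
  · exact hV
  · exact sup_le hV ((Submodule.span_singleton_le_iff_mem _ _).2 hy)

lemma mem_receive_true (V : Submodule F (Comb F)) (y : Comb F) : y ∈ receive V true y :=
  le_sup_right (a := V) (Submodule.mem_span_singleton_self y)

lemma knowledge_cons (C : Scheme F) (x : Pattern) (h : List Pattern) (i : Fin 2) :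
    knowledge C (x :: h) i = receive (knowledge C h i) (x i) (C h) := rfl

lemma required_knowledge_mono (C : Scheme F) (x : Pattern) (h : List Pattern) (i : Fin 2) :
    required (knowledge C h i) ≤ required (knowledge C (x :: h) i) :=
  required_mono (le_receive _ _ _) (exists_not_decoded C _ i)

lemma UsesRequiredPackets.mem_low {C : Scheme F} (hC : UsesRequiredPackets C)
    {h : List Pattern} {m : ℕ} (hm : ∀ i, required (knowledge C h i) < m) : C h ∈ low F m := by
  obtain ⟨α, β, e⟩ := hC h
  rw [e]
  exact add_mem (Submodule.smul_mem _ _ (packet_mem_low.2 (hm 0)))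
    (Submodule.smul_mem _ _ (packet_mem_low.2 (hm 1)))

/-- Nothing beyond the leader's required packet has been transmitted. -/
lemma UsesRequiredPackets.knowledge_le {C : Scheme F} (hC : UsesRequiredPackets C)
    (h : List Pattern) : ∀ {m : ℕ}, (∀ i, required (knowledge C h i) ≤ m) → ∀ i,
    knowledge C h i ≤ low F (m + 1) := by
  induction h with
  | nil => intro m _ i; exact bot_le
  | cons x h ih =>
    intro m hm i
    -- Required indices never decrease, so a bound on the final ones covers all earlier
    -- transmissions.
    have hm' : ∀ i, required (knowledge C h i) ≤ m := fun i =>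
      (required_knowledge_mono C x h i).trans (hm i)
    exact receive_le (ih hm' i) (hC.mem_low fun i => Nat.lt_succ_of_le (hm' i))

lemma Fin.forall_of_ne {a b : Fin 2} (hab : a ≠ b) {P : Fin 2 → Prop} (ha : P a) (hb : P b) :
    ∀ i, P i := by
  intro i
  have : i = a ∨ i = b := by omega
  rcases this with rfl | rfl <;> assumption

variable {C : Scheme F} {a b : Fin 2} {h : List Pattern}

lemma UsesRequiredPackets.knowledge_le_of_le (hC : UsesRequiredPackets C) (hab : a ≠ b)
    (hr : required (knowledge C h b) ≤ required (knowledge C h a)) (i : Fin 2) :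
    knowledge C h i ≤ low F (required (knowledge C h a) + 1) :=
  hC.knowledge_le h (Fin.forall_of_ne hab le_rfl hr) i

/-- The leader knows exactly the packets before its required packet. -/
lemma UsesRequiredPackets.leader_eq (hC : UsesRequiredPackets C) (hab : a ≠ b)
    (hr : required (knowledge C h b) ≤ required (knowledge C h a)) :
    knowledge C h a = low F (required (knowledge C h a)) :=
  eq_low_required (exists_not_decoded C h a) (hC.knowledge_le_of_le hab hr a)

/-- A combination that is innovative for the leader involves the leader's required packet. -/
lemma UsesRequiredPackets.sent_apply_ne (hC : UsesRequiredPackets C) (hab : a ≠ b)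
    (hr : required (knowledge C h b) < required (knowledge C h a))
    (hy : C h ∉ knowledge C h a) : C h (required (knowledge C h a)) ≠ 0 := by
  intro h0
  apply hy
  rw [hC.leader_eq hab hr.le, InOrder.mem_low]
  intro j hj
  rcases hj.eq_or_lt with rfl | hj
  · exact h0
  · have := hC.mem_low (m := required (knowledge C h a) + 1)
      (Fin.forall_of_ne hab (Nat.lt_succ_self _) (by omega))
    exact InOrder.mem_low.1 this j hj

/-- Modulo decoded packets the transmission is a nonzero multiple of the leader's required packet.
The advance is exactly one, because nothing further has been sent. -/
lemma UsesRequiredPackets.leader_receives (hC : UsesRequiredPackets C) (hab : a ≠ b)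
    (hr : required (knowledge C h b) < required (knowledge C h a))
    (hy : C h ∉ knowledge C h a) {x : Pattern} (hx : x a = true) :
    required (knowledge C (x :: h) a) = required (knowledge C h a) + 1 := by
  have hsent := hC.mem_low (h := h) (m := required (knowledge C h a) + 1)
      (Fin.forall_of_ne hab (Nat.lt_succ_self _) (by omega))
  have hle : knowledge C (x :: h) a ≤ low F (required (knowledge C h a) + 1) :=
    receive_le (hC.knowledge_le_of_le hab hr.le a) hsent
  refine le_antisymm (required_le fun hm => ?_) ?_
  · exact lt_irrefl _ (packet_mem_low.1 (hle hm))
  · refine required_lt (le_receive _ _ _) (exists_not_decoded C _ a) ?_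
    have h1 : C h ∈ knowledge C (x :: h) a := by
      rw [knowledge_cons, hx]; exact mem_receive_true _ _
    set r := required (knowledge C h a)
    have hne : C h r ≠ 0 := hC.sent_apply_ne hab hr hy
    have h2 : C h - C h r • packet F r ∈ low F r := by
      rw [InOrder.mem_low]
      intro j hj
      rcases hj.eq_or_lt with rfl | hj
      · simp [packet]
      · have := InOrder.mem_low.1 hsent j hj
        simp [packet, this, hj.ne]
    have h3 : C h - C h r • packet F r ∈ knowledge C (x :: h) a :=
      le_receive _ _ _ (low_required_le _ h2)
    have h4 := sub_mem h1 h3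
    rw [sub_sub_cancel] at h4
    exact (Submodule.smul_mem_iff _ hne).1 h4

/-- User `b` knows a combination that involves packets from the required packet of `a` on. -/
def Ahead (C : Scheme F) (a b : Fin 2) (h : List Pattern) : Prop :=
  ¬ knowledge C h b ≤ low F (required (knowledge C h a))

lemma UsesRequiredPackets.not_ahead_of_leader_receives (hC : UsesRequiredPackets C) (hab : a ≠ b)
    (hr : required (knowledge C h b) < required (knowledge C h a))
    (hy : C h ∉ knowledge C h a) {x : Pattern} (hx : x a = true) : ¬ Ahead C a b (x :: h) := by
  rw [Ahead, not_not, hC.leader_receives hab hr hy hx]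
  exact receive_le (hC.knowledge_le_of_le hab hr.le b)
    (hC.mem_low (Fin.forall_of_ne hab (Nat.lt_succ_self _) (by omega)))

lemma UsesRequiredPackets.ahead_of_lagger_receives (hC : UsesRequiredPackets C) (hab : a ≠ b)
    (hr : required (knowledge C h b) < required (knowledge C h a))
    (hy : C h ∉ knowledge C h a) {x : Pattern} (hxa : x a = false) (hxb : x b = true) :
    Ahead C a b (x :: h) := by
  intro hle
  apply hC.sent_apply_ne hab hr hy
  have h1 : C h ∈ knowledge C (x :: h) b := by
    rw [knowledge_cons, hxb]; exact mem_receive_true _ _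
  have h2 := hle h1
  rw [knowledge_cons C x h a, hxa, receive_false] at h2
  exact InOrder.mem_low.1 h2 _ le_rfl

lemma ahead_cons_of_erased {x : Pattern} (hxa : x a = false) (hxb : x b = false) :
    Ahead C a b (x :: h) ↔ Ahead C a b h := by
  rw [Ahead, Ahead, knowledge_cons, knowledge_cons, hxa, hxb, receive_false, receive_false]

lemma receives_of_burst {i : Fin 2} {x : Pattern}
    (hlt : required (knowledge C h i) < required (knowledge C (x :: h) i)) : x i = true := by
  by_contra hx
  rw [knowledge_cons, Bool.not_eq_true _ |>.mp hx, receive_false] at hlt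
  exact lt_irrefl _ hlt

/-- The lagger decodes its required packet only if it has got ahead. -/
lemma UsesRequiredPackets.ahead_of_burst (hC : UsesRequiredPackets C) (hab : a ≠ b)
    (hr : required (knowledge C h b) < required (knowledge C h a))
    (hy : C h ∉ knowledge C h a) {x : Pattern}
    (hlt : required (knowledge C h b) < required (knowledge C (x :: h) b)) : Ahead C a b h := by
  intro hle
  have hm : packet F (required (knowledge C h b)) ∈ knowledge C (x :: h) b :=
    decoded_of_lt_required hlt
  rw [knowledge_cons, receives_of_burst hlt, receive_true, Submodule.mem_sup] at hm
  obtain ⟨v, hv, z, hz, e⟩ := hm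
  obtain ⟨c, rfl⟩ := Submodule.mem_span_singleton.1 hz
  -- Compare coefficients at the leader's required index: `v` and the packet vanish there and the
  -- transmission does not. Hence `c = 0`, and the packet was already known.
  have h1 := congrArg (fun f : Comb F => f (required (knowledge C h a))) e
  have h2 := InOrder.mem_low.1 (hle hv) _ le_rfl
  have h3 : c = 0 := by
    have h4 : packet F (required (knowledge C h b)) (required (knowledge C h a)) = 0 :=
      Finsupp.single_eq_of_ne (by omega)
    simp only [Finsupp.add_apply, Finsupp.smul_apply, h2, h4, smul_eq_mul, zero_add] at h1
    exact (mul_eq_zero.1 h1).resolve_right (hC.sent_apply_ne hab hr hy)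
  rw [h3, zero_smul, add_zero] at e
  exact packet_required_notMem (exists_not_decoded C h b) (e ▸ hv)

end Algebra

/-! ### The greedy rule: always innovative, and it uses every opportunity of the lagger -/

section Greedy

variable (F : Type*) [Field F]

/-- For a user whose knowledge is spanned by packets, being ahead is the same as having decoded the
leader's required packet, which is what the greedy rule tests. -/
lemma exists_packet_of_not_le_low {V : Submodule F (Comb F)} {m : ℕ} {D : Set ℕ}
    (hD : V = Finsupp.supported F F D) (hle : V ≤ low F (m + 1)) (hn : ¬ V ≤ low F m) :
    packet F m ∈ V := by
  subst hD
  by_contra hm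
  apply hn
  refine Finsupp.supported_mono fun j hj => ?_
  have h1 : packet F j ∈ Finsupp.supported F F D := Finsupp.single_mem_supported _ _ hj
  have h2 := packet_mem_low.1 (hle h1)
  have h3 : j ≠ m := by rintro rfl; exact hm h1
  exact lt_of_le_of_ne (Nat.lt_succ_iff.1 h2) h3

lemma receive_packet_supported (D : Set ℕ) (j : ℕ) :
    Finsupp.supported F F D ⊔ Submodule.span F {packet F j}
      = Finsupp.supported F F (D ∪ {j}) := by
  rw [Finsupp.supported_union, Finsupp.supported_eq_span_single F {j}, Set.image_singleton]
  rfl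

variable {F}

lemma sup_span_add_of_mem {V : Submodule F (Comb F)} {u v : Comb F} (hu : u ∈ V) :
    V ⊔ Submodule.span F {u + v} = V ⊔ Submodule.span F {v} := by
  apply le_antisymm <;> refine sup_le le_sup_left ((Submodule.span_singleton_le_iff_mem _ _).2 ?_)
  · exact add_mem (le_sup_left (b := Submodule.span F {v}) hu)
      (le_sup_right (a := V) (Submodule.mem_span_singleton_self v))
  · have := sub_mem (le_sup_right (a := V) (Submodule.mem_span_singleton_self (u + v)))
      (le_sup_left (b := Submodule.span F {u + v}) hu)
    simpa using this

/-- What the greedy rule gives to user `i`: a packet that it has not decoded, up to a packet that it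
has decoded. -/
lemma greedyRule_cases {V : Fin 2 → Submodule F (Comb F)} (hV : ∀ i, ∃ j, ¬ Decoded (V i) j)
    (i : Fin 2) : ∃ u ∈ V i, ∃ j, packet F j ∉ V i ∧ greedyRule V = u + packet F j := by
  classical
  have h0 := packet_required_notMem (hV 0)
  have h1 := packet_required_notMem (hV 1)
  unfold greedyRule
  simp only
  split_ifs with hc
  · obtain ⟨lag, lead, hlt, hd, hnd⟩ := hc
    simp only [Decoded] at hd hnd
    match lag, lead with
    | 0, 0 => exact absurd hlt (lt_irrefl _)
    | 1, 1 => exact absurd hlt (lt_irrefl _)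
    | 0, 1 =>
      simp only [max_eq_right hlt.le, min_eq_left hlt.le] at *
      match i with
      | 0 => exact ⟨_, hd, _, h0, rfl⟩
      | 1 => exact ⟨_, decoded_of_lt_required hlt, _, h1, add_comm _ _⟩
    | 1, 0 =>
      simp only [max_eq_left hlt.le, min_eq_right hlt.le] at *
      match i with
      | 1 => exact ⟨_, hd, _, h1, rfl⟩
      | 0 => exact ⟨_, decoded_of_lt_required hlt, _, h0, add_comm _ _⟩
  -- The larger required packet is sent uncoded. A user that had already decoded it would be a
  -- lagger fulfilling the condition for the sum.
  · refine ⟨0, zero_mem _, max (required (V 0)) (required (V 1)), ?_, (zero_add _).symm⟩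
    intro hi
    apply hc
    rcases lt_trichotomy (required (V 0)) (required (V 1)) with hlt | heq | hlt
    · rw [max_eq_right hlt.le] at hi ⊢
      match i with
      | 0 => exact ⟨0, 1, hlt, hi, h1⟩
      | 1 => exact absurd hi h1
    · match i with
      | 0 => rw [← heq, max_self] at hi; exact absurd hi h0
      | 1 => rw [heq, max_self] at hi; exact absurd hi h1
    · rw [max_eq_left hlt.le] at hi ⊢
      match i with
      | 1 => exact ⟨1, 0, hlt, hi, h0⟩
      | 0 => exact absurd hi h0

lemma greedyRule_of_decoded {V : Fin 2 → Submodule F (Comb F)} {a b : Fin 2} (hab : a ≠ b)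
    (ha : ∃ j, ¬ Decoded (V a) j) (hr : required (V b) < required (V a))
    (hd : packet F (required (V a)) ∈ V b) :
    greedyRule V = packet F (required (V a)) + packet F (required (V b)) := by
  classical
  have hmax : max (required (V 0)) (required (V 1)) = required (V a) ∧
      min (required (V 0)) (required (V 1)) = required (V b) := by
    match a, b with
    | 0, 0 => exact absurd rfl hab
    | 0, 1 => exact ⟨max_eq_left hr.le, min_eq_right hr.le⟩
    | 1, 0 => exact ⟨max_eq_right hr.le, min_eq_left hr.le⟩
    | 1, 1 => exact absurd rfl hab
  unfold greedyRule
  simp only [hmax.1, hmax.2]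
  rw [if_pos ⟨b, a, hr, hd, packet_required_notMem ha⟩]

lemma greedy_innovative (h : List Pattern) (i : Fin 2) :
    greedy F h ∉ knowledge (greedy F) h i := by
  rw [greedy_apply]
  obtain ⟨u, hu, j, hj, e⟩ := greedyRule_cases (exists_not_decoded (greedy F) h) i
  rw [e]
  exact fun hm => hj ((Submodule.add_mem_iff_right _ hu).1 hm)

/-- Modulo decoded packets each greedy transmission is a single packet, so knowledge remains a
coordinate subspace. -/
lemma greedy_knowledge_eq_supported (h : List Pattern) (i : Fin 2) :
    ∃ D : Set ℕ, knowledge (greedy F) h i = Finsupp.supported F F D := by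
  induction h with
  | nil => exact ⟨∅, by simp [knowledge]⟩
  | cons x h ih =>
    obtain ⟨D, hD⟩ := ih
    rw [knowledge_cons, greedy_apply]
    cases x i
    · exact ⟨D, hD⟩
    · obtain ⟨u, hu, j, -, e⟩ := greedyRule_cases (exists_not_decoded (greedy F) h) i
      rw [e, receive_true, sup_span_add_of_mem hu, hD, receive_packet_supported]
      exact ⟨_, rfl⟩

lemma usesRequiredPackets_greedy (F : Type*) [Field F] : UsesRequiredPackets (greedy F) := by
  classical
  intro h
  rw [greedy_apply]
  unfold greedyRule
  simp only
  rcases le_total (required (knowledge (greedy F) h 0)) (required (knowledge (greedy F) h 1))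
    with hle | hle
  · rw [max_eq_right hle, min_eq_left hle]
    split_ifs
    · exact ⟨1, 1, by rw [one_smul, one_smul, add_comm]⟩
    · exact ⟨0, 1, by rw [zero_smul, one_smul, zero_add]⟩
  · rw [max_eq_left hle, min_eq_right hle]
    split_ifs
    · exact ⟨1, 1, by rw [one_smul, one_smul]⟩
    · exact ⟨1, 0, by rw [one_smul, zero_smul, add_zero]⟩

/-- Converse of `ahead_of_burst` for greedy: the lagger has the leader's packet and removes it from
the transmitted sum. -/
lemma greedy_burst_of_ahead {a b : Fin 2} (hab : a ≠ b) {h : List Pattern} {x : Pattern}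
    (hr : required (knowledge (greedy F) h b) < required (knowledge (greedy F) h a))
    (hs : Ahead (greedy F) a b h) (hx : x b = true) :
    required (knowledge (greedy F) h b) < required (knowledge (greedy F) (x :: h) b) := by
  obtain ⟨D, hD⟩ := greedy_knowledge_eq_supported (F := F) h b
  have hd := exists_packet_of_not_le_low F hD
    ((usesRequiredPackets_greedy F).knowledge_le_of_le hab hr.le b) hs
  refine required_lt (le_receive _ _ _) (exists_not_decoded _ _ b) ?_
  rw [knowledge_cons, hx, greedy_apply,
    greedyRule_of_decoded hab (exists_not_decoded _ _ a) hr hd, receive_true,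
    sup_span_add_of_mem hd]
  exact mem_receive_true _ _

end Greedy

/-! ### Deterministic counting of slots -/

section Counting

open Classical in
/-- The number of slots among the first `n` with a given property. -/
noncomputable def slots (P : ℕ → Prop) (n : ℕ) : ℕ := Nat.count P n

@[simp]
lemma slots_zero (P : ℕ → Prop) : slots P 0 = 0 := by
  classical exact Nat.count_zero _

lemma slots_succ (P : ℕ → Prop) (n : ℕ) [Decidable (P n)] :
    slots P (n + 1) = slots P n + if P n then 1 else 0 := by
  classical
  rw [slots, slots, Nat.count_succ]
  congr

lemma slots_eq_card (P : ℕ → Prop) [DecidablePred P] (n : ℕ) :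
    slots P n = ((Finset.range n).filter P).card := by
  rw [slots, Nat.count_eq_card_filter_range]
  congr!

lemma slots_monotone (P : ℕ → Prop) : Monotone (slots P) := by
  classical exact Nat.count_monotone P

lemma slots_le (P : ℕ → Prop) (n : ℕ) : slots P n ≤ n := by
  classical exact Nat.count_le P

lemma slots_mono_pred {P Q : ℕ → Prop} (h : ∀ k, P k → Q k) (n : ℕ) : slots P n ≤ slots Q n := by
  classical
  rw [slots_eq_card, slots_eq_card]
  exact Finset.card_le_card (Finset.monotone_filter_right _ fun k _ => h k)

/-- If `u` implies `v` up to mismatches `d`, which can arise only where `g` fails and each of which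
accounts for at most one exception, then `u` is at most as frequent as `v` up to twice the failures
of `g`. -/
lemma slots_le_count_add {u v d g : ℕ → Prop} (h0 : ¬ d 0)
    (hd : ∀ k, g k → d (k + 1) → d k)
    (hu : ∀ k, g k → u k → v k ∨ (d k ∧ ¬ d (k + 1))) (n : ℕ) :
    slots u n ≤ slots v n + 2 * slots (fun k => ¬ g k) n := by
  classical
  -- The induction carries a pending mismatch on the left. A slot where `g` fails may be an
  -- exception itself and may also create a mismatch, hence the factor 2.
  have key : slots u n + (if d n then 1 else 0)
      ≤ slots v n + 2 * slots (fun k => ¬ g k) n := by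
    induction n with
    | zero => simp [h0]
    | succ n ih =>
      have h1 := hd n
      have h2 := hu n
      rw [slots_succ, slots_succ, slots_succ]
      by_cases hg : g n <;> by_cases hun : u n <;> by_cases hvn : v n <;> by_cases hdn : d n <;>
        by_cases hdn' : d (n + 1) <;> simp_all <;> omega
  omega

/-- Once the linear bound holds, a counted slot `k < n` satisfies `d * k ≤ y k + 1 ≤ y n + 1`. The
constant `K` does not depend on `y`, which will count redundant receptions. -/
lemma slots_le_of_linear_gap {x : ℕ → ℕ} {d : ℝ} (hd : 0 < d)
    (hx : ∀ᶠ k : ℕ in atTop, d * k ≤ x k) :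
    ∃ K : ℝ, ∀ y : ℕ → ℕ, Monotone y → ∀ n,
      (slots (fun k => x k ≤ y k + 1) n : ℝ) ≤ K + d⁻¹ * y n := by
  obtain ⟨K, hK⟩ := eventually_atTop.1 hx
  refine ⟨K + d⁻¹ + 1, fun y hy n => ?_⟩
  classical
  have hsub : (Finset.range n).filter (fun k => x k ≤ y k + 1) ⊆
      Finset.range K ∪ Finset.range (⌊d⁻¹ * (y n + 1)⌋₊ + 1) := by
    intro k hk
    rw [Finset.mem_filter, Finset.mem_range] at hk
    rw [Finset.mem_union, Finset.mem_range, Finset.mem_range]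
    by_cases hkK : k < K
    · exact Or.inl hkK
    · right
      rw [Nat.lt_succ_iff]
      apply Nat.le_floor
      rw [← div_eq_inv_mul, le_div_iff₀ hd, mul_comm]
      refine (hK k (not_lt.1 hkK)).trans ?_
      have := hk.2.trans (Nat.add_le_add_right (hy hk.1.le) 1)
      exact_mod_cast this
  have hcard := (Finset.card_le_card hsub).trans (Finset.card_union_le _ _)
  rw [Finset.card_range, Finset.card_range] at hcard
  rw [slots_eq_card]
  have hfl : (⌊d⁻¹ * (y n + 1)⌋₊ : ℝ) ≤ d⁻¹ * (y n + 1) := Nat.floor_le (by positivity)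
  have : (((Finset.range n).filter (fun k => x k ≤ y k + 1)).card : ℝ) ≤
      (K : ℝ) + ((⌊d⁻¹ * (y n + 1)⌋₊ : ℝ) + 1) := by exact_mod_cast hcard
  linarith

end Counting

/-! ### Pathwise comparison of a scheme with the channel process -/

section Paths

variable {F : Type*} [Field F] {Ω : Type*} {R : Fin 2 → ℕ → Ω → Bool} {C : Ω → Scheme F}
  {a b : Fin 2} {ω : Ω}

lemma received_eq_slots (i : Fin 2) (n : ℕ) :
    received R i n ω = slots (fun k => R i k ω = true) n := by
  rw [received, slots_eq_card]

lemma redundant_eq_slots (i : Fin 2) (n : ℕ) : redundant R C i n ω =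
    slots (fun k => R i k ω = true ∧ sent R C k ω ∈ knows R C i k ω) n := by
  classical
  rw [redundant, slots_eq_card]

lemma bursts_eq_slots (i : Fin 2) (n : ℕ) : bursts R C i n ω =
    slots (fun k => requiredAt R C i k ω < requiredAt R C i (k + 1) ω) n := by
  classical
  rw [bursts, slots_eq_card]

lemma redundant_mono (i : Fin 2) : Monotone fun n => redundant R C i n ω := by
  intro m n h
  simp only [redundant_eq_slots]
  exact slots_monotone _ h

lemma redundant_le_received (i : Fin 2) (n : ℕ) : redundant R C i n ω ≤ received R i n ω := by
  rw [redundant_eq_slots, received_eq_slots]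
  exact slots_mono_pred (fun _ h => h.1) n

lemma received_le (i : Fin 2) (n : ℕ) : received R i n ω ≤ n := by
  rw [received_eq_slots]
  exact slots_le _ _

lemma bursts_le_received (i : Fin 2) (n : ℕ) : bursts R C i n ω ≤ received R i n ω := by
  rw [bursts_eq_slots, received_eq_slots]
  exact slots_mono_pred (fun k h => receives_of_burst (x := fun i => R i k ω) h) n

lemma redundant_greedy (i : Fin 2) (n : ℕ) :
    redundant R (fun _ => greedy F) i n ω = 0 := by
  classical
  rw [redundant_eq_slots, slots_eq_card, Finset.card_eq_zero,
    Finset.filter_eq_empty_iff]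
  exact fun k _ h => greedy_innovative _ i h.2

instance finiteDimensional_knowledge (C : Scheme F) (h : List Pattern) (i : Fin 2) :
    FiniteDimensional F (knowledge C h i) := by
  induction h with
  | nil => exact inferInstanceAs (FiniteDimensional F (⊥ : Submodule F (Comb F)))
  | cons x h ih =>
    rw [knowledge_cons]
    cases x i
    · exact ih
    · rw [receive_true]; infer_instance

lemma finrank_sup_span_of_notMem {V : Submodule F (Comb F)} [FiniteDimensional F V] {y : Comb F}
    (hy : y ∉ V) : Module.finrank F ↥(V ⊔ Submodule.span F {y}) = Module.finrank F V + 1 := by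
  have hy0 : y ≠ 0 := fun h => hy (h ▸ V.zero_mem)
  have h := Submodule.finrank_sup_add_finrank_inf_eq V (Submodule.span F {y})
  have hd : V ⊓ Submodule.span F {y} = ⊥ := by
    rw [← disjoint_iff]
    exact (Submodule.disjoint_span_singleton' hy0).2 hy
  rw [hd, finrank_bot, finrank_span_singleton hy0] at h
  exact h

/-- The dimension of what a user knows is the number of its innovative receptions. -/
lemma finrank_knows_add_redundant (i : Fin 2) (n : ℕ) :
    Module.finrank F (knows R C i n ω) + redundant R C i n ω = received R i n ω := by
  classical
  simp only [redundant_eq_slots, received_eq_slots]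
  induction n with
  | zero =>
    have : knows R C i 0 ω = ⊥ := rfl
    rw [this]
    simp
  | succ n ih =>
    rw [slots_succ, slots_succ]
    have hk : knows R C i (n + 1) ω = receive (knows R C i n ω) (R i n ω) (sent R C n ω) := rfl
    have hfin : FiniteDimensional F (knows R C i n ω) := finiteDimensional_knowledge _ _ _
    rw [hk]
    by_cases hR : R i n ω = true
    · rw [hR, receive_true]
      by_cases hy : sent R C n ω ∈ knows R C i n ω
      · rw [sup_eq_left.2 ((Submodule.span_singleton_le_iff_mem _ _).2 hy)]
        simp only [hy, and_self, if_true]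
        omega
      · rw [finrank_sup_span_of_notMem hy]
        simp only [hy, and_false, if_false, if_true]
        omega
    · rw [Bool.not_eq_true] at hR
      rw [hR, receive_false]
      simp only [Bool.false_eq_true, false_and, if_false]
      omega

/-- Dimension count: `b` knows exactly the packets before its required one, and the knowledge of `a`
reaches at most one packet further. -/
lemma received_le_of_not_leader (hC : UsesRequiredPackets (C ω)) (hab : a ≠ b) {k : ℕ}
    (hr : requiredAt R C a k ω ≤ requiredAt R C b k ω) :
    received R a k ω ≤ received R b k ω + redundant R C a k ω + 1 := by
  have h1 := finrank_knows_add_redundant (R := R) (C := C) (ω := ω) a k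
  have h2 := finrank_knows_add_redundant (R := R) (C := C) (ω := ω) b k
  have hb : Module.finrank F (knows R C b k ω) = requiredAt R C b k ω := by
    have := hC.leader_eq hab.symm (h := history R k ω) hr
    rw [knows, this, finrank_low]
    rfl
  have ha : Module.finrank F (knows R C a k ω) ≤ requiredAt R C b k ω + 1 := by
    have := Submodule.finrank_mono (hC.knowledge_le_of_le hab.symm (h := history R k ω) hr a)
    rw [finrank_low] at this
    exact this
  omega

variable (R C a b ω) in
/-- The slots in which `a` is the leader and the transmission is innovative for `a`. -/
def Regular (k : ℕ) : Prop :=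
  requiredAt R C b k ω < requiredAt R C a k ω ∧ sent R C k ω ∉ knows R C a k ω

variable (R a b ω) in
/-- The last slot so far that was not erased for both users was received by `b` only. -/
def LastOnly : ℕ → Prop
  | 0 => False
  | n + 1 => R a n ω = false ∧ (R b n ω = true ∨ LastOnly n)

/-- In a regular slot `Ahead` follows the recursion that defines `LastOnly`, whatever the scheme. -/
lemma Regular.ahead_succ (hC : UsesRequiredPackets (C ω)) (hab : a ≠ b) {k : ℕ}
    (hk : Regular R C a b ω k) : Ahead (C ω) a b (history R (k + 1) ω) ↔
      R a k ω = false ∧ (R b k ω = true ∨ Ahead (C ω) a b (history R k ω)) := by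
  by_cases ha : R a k ω = true
  · rw [ha]
    have := hC.not_ahead_of_leader_receives hab hk.1 hk.2 (x := fun i => R i k ω) ha
    simpa [history] using this
  · rw [Bool.not_eq_true] at ha
    by_cases hb : R b k ω = true
    · have := hC.ahead_of_lagger_receives hab hk.1 hk.2 (x := fun i => R i k ω) ha hb
      simpa [ha, hb, history] using this
    · rw [Bool.not_eq_true] at hb
      have := ahead_cons_of_erased (C := C ω) (h := history R k ω) (x := fun i => R i k ω) ha hb
      simpa [ha, hb, history] using this

lemma not_ahead_zero : ¬ Ahead (C ω) a b (history R 0 ω) := by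
  simp [Ahead, history, knowledge]

lemma bursts_le_slots (hC : UsesRequiredPackets (C ω)) (hab : a ≠ b) (n : ℕ) :
    bursts R C b n ω ≤ slots (fun k => LastOnly R a b ω k ∧ R b k ω = true) n
      + 2 * slots (fun k => ¬ Regular R C a b ω k) n := by
  rw [bursts_eq_slots]
  refine slots_le_count_add
    -- A mismatch is a disagreement between `Ahead` and `LastOnly`. Regular slots create none, and
    -- one in which `b` receives removes it, both next states then being decided by whether `a`
    -- receives.
    (d := fun k => ¬ (Ahead (C ω) a b (history R k ω) ↔ LastOnly R a b ω k)) ?_ ?_ ?_ n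
  · simp [not_ahead_zero, LastOnly]
  · intro k hk
    rw [hk.ahead_succ hC hab, LastOnly]
    tauto
  · intro k hk hlt
    have hR : R b k ω = true := receives_of_burst (x := fun i => R i k ω) hlt
    have hA : Ahead (C ω) a b (history R k ω) :=
      hC.ahead_of_burst hab hk.1 hk.2 (x := fun i => R i k ω) hlt
    rw [hk.ahead_succ hC hab, LastOnly]
    tauto

lemma slots_le_bursts_greedy (hab : a ≠ b) (n : ℕ) :
    slots (fun k => LastOnly R a b ω k ∧ R b k ω = true) n ≤
      bursts R (fun _ => greedy F) b n ω
        + 2 * slots (fun k => ¬ Regular R (fun _ => greedy F) a b ω k) n := by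
  rw [bursts_eq_slots]
  refine slots_le_count_add
    (d := fun k => ¬ (Ahead (greedy F) a b (history R k ω) ↔ LastOnly R a b ω k)) ?_ ?_ ?_ n
  · have := not_ahead_zero (R := R) (C := fun _ => greedy F) (a := a) (b := b) (ω := ω)
    simp [this, LastOnly]
  · intro k hk
    rw [hk.ahead_succ (usesRequiredPackets_greedy F) hab, LastOnly]
    tauto
  · rintro k hk ⟨hL, hR⟩
    have h1 := greedy_burst_of_ahead (F := F) hab (h := history R k ω) (x := fun i => R i k ω) hk.1
    rw [hk.ahead_succ (usesRequiredPackets_greedy F) hab, LastOnly]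
    by_cases hA : Ahead (greedy F) a b (history R k ω)
    · exact Or.inl (h1 hA hR)
    · right
      tauto

lemma received_le_bursts_greedy (hab : a ≠ b) (n : ℕ) :
    received R a n ω ≤ bursts R (fun _ => greedy F) a n ω
      + slots (fun k => ¬ Regular R (fun _ => greedy F) a b ω k) n := by
  classical
  rw [received_eq_slots, bursts_eq_slots]
  induction n with
  | zero => simp
  | succ n ih =>
    rw [slots_succ, slots_succ, slots_succ]
    have : R a n ω = true → Regular R (fun _ => greedy F) a b ω n →
        requiredAt R (fun _ => greedy F) a n ω < requiredAt R (fun _ => greedy F) a (n + 1) ω := by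
      intro hR hk
      have := (usesRequiredPackets_greedy F).leader_receives hab hk.1 hk.2
        (x := fun i => R i n ω) hR
      exact Nat.lt_of_lt_of_eq (Nat.lt_succ_self _) this.symm
    split_ifs <;> first | omega | (exfalso; tauto)

/-- The difference of receptions is truncated at zero; this is harmless, because slots where `b` has
received at least as much as `a` are counted on the right anyway. -/
lemma slots_not_regular_le (hC : UsesRequiredPackets (C ω)) (hab : a ≠ b) (n : ℕ) :
    slots (fun k => ¬ Regular R C a b ω k) n ≤
      slots (fun k => received R a k ω - received R b k ω ≤ redundant R C a k ω + 1) n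
        + slots (fun k => sent R C k ω ∈ knows R C a k ω) n := by
  classical
  induction n with
  | zero => simp
  | succ n ih =>
    rw [slots_succ, slots_succ, slots_succ]
    have : ¬ Regular R C a b ω n → sent R C n ω ∉ knows R C a n ω →
        received R a n ω - received R b n ω ≤ redundant R C a n ω + 1 := by
      intro h1 h2
      have h3 : requiredAt R C a n ω ≤ requiredAt R C b n ω := by
        by_contra h3
        exact h1 ⟨not_le.1 h3, h2⟩
      have := received_le_of_not_leader hC hab h3
      omega
    split_ifs <;> first | omega | (exfalso; tauto)

/-- If `a` receives more often than `b`, then the irregular slots are essentially those in which the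
transmission is not innovative for `a`. -/
lemma exists_slots_not_regular_le (hab : a ≠ b) {p : Fin 2 → ℝ} (hp : p b < p a)
    (hlln : ∀ i, Tendsto (fun n : ℕ => (received R i n ω : ℝ) / n) atTop (nhds (p i))) :
    ∃ K c : ℝ, ∀ C : Ω → Scheme F, UsesRequiredPackets (C ω) → ∀ n,
      (slots (fun k => ¬ Regular R C a b ω k) n : ℝ) ≤
        K + c * redundant R C a n ω + slots (fun k => sent R C k ω ∈ knows R C a k ω) n := by
  set d := (p a - p b) / 2 with hd
  have hd0 : 0 < d := by rw [hd]; linarith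
  have hev : ∀ᶠ k : ℕ in atTop, d * k ≤ ((received R a k ω - received R b k ω : ℕ) : ℝ) := by
    have h1 := (hlln a).sub (hlln b)
    have h2 : d < p a - p b := by rw [hd]; linarith
    filter_upwards [h1.eventually (lt_mem_nhds h2), eventually_gt_atTop 0] with k hk hk0
    have hk0' : (0 : ℝ) < k := by exact_mod_cast hk0
    rw [← sub_div, lt_div_iff₀ hk0'] at hk
    refine hk.le.trans ?_
    have h3 : received R a k ω ≤ (received R a k ω - received R b k ω) + received R b k ω := by
      omega
    have h4 : (received R a k ω : ℝ) ≤
        ((received R a k ω - received R b k ω : ℕ) : ℝ) + received R b k ω := by exact_mod_cast h3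
    linarith
  obtain ⟨K, hK⟩ := slots_le_of_linear_gap hd0 hev
  refine ⟨K, d⁻¹, fun C hC n => ?_⟩
  have h1 := slots_not_regular_le (R := R) hC hab n
  have h2 := hK _ (redundant_mono (R := R) (C := C) (ω := ω) a) n
  have h3 : (slots (fun k => ¬ Regular R C a b ω k) n : ℝ) ≤
      slots (fun k => received R a k ω - received R b k ω ≤ redundant R C a k ω + 1) n
        + slots (fun k => sent R C k ω ∈ knows R C a k ω) n := by exact_mod_cast h1
  linarith

end Paths

/-! ### Convergence in measure and a weak law for orthogonal sequences -/

section WeakLaw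

lemma abs_sum_range_le {Ω : Type*} {f : ℕ → Ω → ℝ} (hb : ∀ k ω, |f k ω| ≤ 1) (n : ℕ) (ω : Ω) :
    |∑ k ∈ Finset.range n, f k ω| ≤ n := by
  refine (Finset.abs_sum_le_sum_abs _ _).trans ?_
  refine (Finset.sum_le_sum fun k _ => hb k ω).trans ?_
  simp

variable {Ω : Type*} [MeasurableSpace Ω] {μ : Measure Ω} [IsProbabilityMeasure μ]

lemma tendstoInMeasure_of_abs_sub_le {f u v : ℕ → Ω → ℝ} {c K : ℝ} (hK : 0 < K)
    (hu : TendstoInMeasure μ u atTop fun _ => 0) (hv : TendstoInMeasure μ v atTop fun _ => 0)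
    (h : ∀ᶠ n in atTop, ∀ ω, |f n ω - c| ≤ K * (|u n ω| + |v n ω|)) :
    TendstoInMeasure μ f atTop fun _ => c := by
  rw [tendstoInMeasure_iff_measureReal_norm] at *
  intro ε hε
  have hε' : 0 < ε / (2 * K) := by positivity
  have h1 := (hu _ hε').add (hv _ hε')
  rw [add_zero] at h1
  refine squeeze_zero' (Eventually.of_forall fun _ => measureReal_nonneg) ?_ h1
  filter_upwards [h] with n hn
  refine (measureReal_mono ?_).trans (measureReal_union_le _ _)
  intro ω hω
  simp only [Set.mem_ofPred_eq, Set.mem_union, Real.norm_eq_abs, sub_zero] at *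
  by_contra hcon
  push Not at hcon
  have h2 : K * (|u n ω| + |v n ω|) < K * (ε / (2 * K) + ε / (2 * K)) :=
    mul_lt_mul_of_pos_left (add_lt_add hcon.1 hcon.2) hK
  have h3 : K * (ε / (2 * K) + ε / (2 * K)) = ε := by field_simp; ring
  linarith [hn ω]

lemma tendstoInMeasure_of_tendsto {u : ℕ → ℝ} {c : ℝ} (hu : Tendsto u atTop (nhds c)) :
    TendstoInMeasure μ (fun n _ => u n) atTop fun _ => c :=
  tendstoInMeasure_of_tendsto_ae (fun _ => aestronglyMeasurable_const) (ae_of_all _ fun _ => hu)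

lemma integrable_of_abs_le {f : Ω → ℝ} (hm : Measurable f) {c : ℝ} (hb : ∀ ω, |f ω| ≤ c) :
    Integrable f μ :=
  Integrable.of_bound hm.aestronglyMeasurable c (ae_of_all _ hb)

lemma integral_sq_sum_le_of_orthogonal {f : ℕ → Ω → ℝ} (hm : ∀ k, Measurable (f k))
    (hb : ∀ k ω, |f k ω| ≤ 1) (ho : ∀ j k, j < k → ∫ ω, f j ω * f k ω ∂μ = 0) (n : ℕ) :
    ∫ ω, (∑ k ∈ Finset.range n, f k ω) ^ 2 ∂μ ≤ n := by
  induction n with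
  | zero => simp
  | succ n ih =>
    have hS : Measurable fun ω => ∑ k ∈ Finset.range n, f k ω :=
      Finset.measurable_fun_sum _ fun k _ => hm k
    have e : ∀ ω, (∑ k ∈ Finset.range (n + 1), f k ω) ^ 2 =
        (∑ k ∈ Finset.range n, f k ω) ^ 2 +
          (2 * (∑ k ∈ Finset.range n, f k ω * f n ω) + f n ω ^ 2) := by
      intro ω
      rw [Finset.sum_range_succ, ← Finset.sum_mul]
      ring
    have hmul : ∀ j k, Integrable (fun ω => f j ω * f k ω) μ := fun j k =>
      integrable_of_abs_le ((hm j).mul (hm k)) (c := 1) fun ω => by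
        rw [abs_mul]; exact mul_le_one₀ (hb j ω) (abs_nonneg _) (hb k ω)
    have hsq : ∀ ω, f n ω ^ 2 ≤ 1 := fun ω => by
      rw [← sq_abs]; exact pow_le_one₀ (abs_nonneg _) (hb n ω)
    have i1 : Integrable (fun ω => (∑ k ∈ Finset.range n, f k ω) ^ 2) μ :=
      integrable_of_abs_le (hS.pow_const 2) (c := (n : ℝ) ^ 2) fun ω => by
        rw [abs_pow]
        exact pow_le_pow_left₀ (abs_nonneg _) (abs_sum_range_le hb n ω) 2
    have i2 : Integrable (fun ω => 2 * ∑ k ∈ Finset.range n, f k ω * f n ω) μ :=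
      (integrable_finsetSum _ fun k _ => hmul k n).const_mul 2
    have i3 : Integrable (fun ω => f n ω ^ 2) μ := by simpa only [sq] using hmul n n
    simp only [e]
    have i23 : Integrable (fun ω => 2 * ∑ k ∈ Finset.range n, f k ω * f n ω + f n ω ^ 2) μ :=
      i2.add i3
    rw [integral_add i1 i23, integral_add i2 i3, integral_const_mul,
      integral_finsetSum _ fun k _ => hmul k n,
      Finset.sum_eq_zero fun k hk => ho k n (Finset.mem_range.1 hk)]
    have h3 : ∫ ω, f n ω ^ 2 ∂μ ≤ 1 := by
      have := integral_mono i3 (integrable_const (1 : ℝ)) hsq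
      simpa using this
    push_cast
    linarith

/-- A weak law of large numbers for bounded orthogonal sequences. -/
lemma weak_law_of_orthogonal {f : ℕ → Ω → ℝ} (hm : ∀ k, Measurable (f k))
    (hb : ∀ k ω, |f k ω| ≤ 1) (ho : ∀ j k, j < k → ∫ ω, f j ω * f k ω ∂μ = 0) :
    TendstoInMeasure μ (fun n ω => (∑ k ∈ Finset.range n, f k ω) / n) atTop fun _ => 0 := by
  rw [tendstoInMeasure_iff_measureReal_norm]
  intro ε hε
  have hlim : Tendsto (fun n : ℕ => (ε ^ 2)⁻¹ * (n : ℝ)⁻¹) atTop (nhds 0) := by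
    simpa using tendsto_inv_atTop_nhds_zero_nat.const_mul ((ε ^ 2)⁻¹)
  refine squeeze_zero' (Eventually.of_forall fun _ => measureReal_nonneg) ?_ hlim
  filter_upwards [eventually_gt_atTop 0] with n hn
  have hn' : (0 : ℝ) < n := by exact_mod_cast hn
  have hS : Measurable fun ω => ∑ k ∈ Finset.range n, f k ω :=
    Finset.measurable_fun_sum _ fun k _ => hm k
  have i1 : Integrable (fun ω => (∑ k ∈ Finset.range n, f k ω) ^ 2) μ :=
    integrable_of_abs_le (hS.pow_const 2) (c := (n : ℝ) ^ 2) fun ω => by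
      rw [abs_pow]
      exact pow_le_pow_left₀ (abs_nonneg _) (abs_sum_range_le hb n ω) 2
  -- Chebyshev's inequality: the second moment of the sum grows at most linearly.
  have h1 := (mul_meas_ge_le_integral_of_nonneg (ae_of_all μ fun ω => sq_nonneg _) i1
    ((ε * n) ^ 2)).trans (integral_sq_sum_le_of_orthogonal hm hb ho n)
  have hsub : {ω | ε ≤ ‖(∑ k ∈ Finset.range n, f k ω) / n - 0‖} ⊆
      {ω | (ε * n) ^ 2 ≤ (∑ k ∈ Finset.range n, f k ω) ^ 2} := by
    intro ω hω
    simp only [Set.mem_ofPred_eq, sub_zero, Real.norm_eq_abs, abs_div, Nat.abs_cast] at *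
    rw [le_div_iff₀ hn'] at hω
    rw [← sq_abs (∑ k ∈ Finset.range n, f k ω)]
    exact pow_le_pow_left₀ (by positivity) hω 2
  have h2 := measureReal_mono hsub (μ := μ)
  have h3 : (ε * n) ^ 2 * μ.real {ω | ε ≤ ‖(∑ k ∈ Finset.range n, f k ω) / n - 0‖} ≤ n :=
    (mul_le_mul_of_nonneg_left h2 (by positivity)).trans h1
  rw [← mul_inv, ← one_div, le_div_iff₀ (by positivity)]
  have h4 : (n : ℝ) * (μ.real {ω | ε ≤ ‖(∑ k ∈ Finset.range n, f k ω) / n - 0‖} * (ε ^ 2 * n))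
      ≤ n * 1 := by
    rw [mul_one]
    calc _ = _ := by ring
      _ ≤ _ := h3
  exact le_of_mul_le_mul_left h4 hn'

end WeakLaw

/-! ### Measurability for discrete σ-algebras -/

section Discrete

variable {Ω : Type*} {m : MeasurableSpace Ω} {α β γ : Type*}

lemma measurable_top_comp {f : Ω → α} (hf : Measurable[m, ⊤] f) (φ : α → β) :
    Measurable[m, ⊤] fun ω => φ (f ω) :=
  fun s _ => hf (t := φ ⁻¹' s) trivial

/-- Splitting by the countably many values of `g` makes a random scheme measurable when evaluated at
a random history. -/
lemma measurable_top_eval [Countable β] {f : β → Ω → α} {g : Ω → β}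
    (hf : ∀ b, Measurable[m, ⊤] (f b)) (hg : Measurable[m, ⊤] g) :
    Measurable[m, ⊤] fun ω => f (g ω) ω := by
  intro s _
  have : (fun ω => f (g ω) ω) ⁻¹' s = ⋃ b, (g ⁻¹' {b} ∩ f b ⁻¹' s) := by
    ext ω; simp
  rw [this]
  exact MeasurableSet.iUnion fun b => (hg trivial).inter (hf b trivial)

/-- Only one factor has to be countable: in pairs of a subspace and a combination, the subspaces
need not form a countable type. -/
lemma measurable_top_prodMk [Countable β] {f : Ω → α} {g : Ω → β}
    (hf : Measurable[m, ⊤] f) (hg : Measurable[m, ⊤] g) :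
    Measurable[m, ⊤] fun ω => (f ω, g ω) :=
  measurable_top_eval (f := fun b ω => (f ω, b)) (fun b => measurable_top_comp hf (·, b)) hg

lemma measurableSet_of_measurable_top {f : Ω → α} (hf : Measurable[m, ⊤] f) (P : α → Prop) :
    MeasurableSet[m] {ω | P (f ω)} :=
  hf (t := {x | P x}) trivial

end Discrete

/-! ### Independence of the past and the current slot -/

section Independence

/-- Adds the internal randomness of the scheme, as index `none`, to the independent family of
receptions. -/
lemma iIndep_option {Ω ι : Type*} {mΩ : MeasurableSpace Ω} {μ : Measure Ω} [IsProbabilityMeasure μ]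
    {m₀ : MeasurableSpace Ω} {m : ι → MeasurableSpace Ω} (h₀ : Indep m₀ (⨆ i, m i) μ)
    (h : iIndep m μ) : iIndep (fun o : Option ι => o.elim m₀ m) μ := by
  classical
  rw [iIndep_iff] at *
  intro s f hf
  have ht : ∀ i ∈ s.eraseNone, MeasurableSet[m i] (f (some i)) := fun i hi =>
    hf (some i) (Finset.mem_eraseNone.1 hi)
  have hprod := h s.eraseNone ht
  by_cases hn : none ∈ s
  · have hs : s = Finset.insertNone s.eraseNone := by
      rw [Finset.insertNone_eraseNone, Finset.insert_eq_of_mem hn]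
    have hI : (⋂ o ∈ s, f o) = f none ∩ ⋂ i ∈ s.eraseNone, f (some i) := by
      ext ω
      simp only [Set.mem_iInter, Set.mem_inter_iff, Finset.mem_eraseNone]
      constructor
      · exact fun H => ⟨H _ hn, fun i hi => H _ hi⟩
      · rintro ⟨H1, H2⟩ (_ | i) ho
        · exact H1
        · exact H2 i ho
    have hmeas : MeasurableSet[⨆ i, m i] (⋂ i ∈ s.eraseNone, f (some i)) :=
      Finset.measurableSet_biInter _ fun i hi => le_iSup m i _ (ht i hi)
    rw [hI, (Indep_iff _ _ _).1 h₀ _ _ (hf none hn) hmeas, hprod]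
    conv_rhs => rw [hs]
    rw [Finset.prod_insertNone]
  · have hs : s = s.eraseNone.map Function.Embedding.some := by
      rw [Finset.map_some_eraseNone, Finset.erase_eq_of_notMem hn]
    have hI : (⋂ o ∈ s, f o) = ⋂ i ∈ s.eraseNone, f (some i) := by
      ext ω
      simp only [Set.mem_iInter, Finset.mem_eraseNone]
      constructor
      · exact fun H i hi => H _ hi
      · rintro H (_ | i) ho
        · exact absurd ho hn
        · exact H i ho
    rw [hI, hprod]
    conv_rhs => rw [hs]
    rw [Finset.prod_map]
    rfl

variable {F : Type*} [Field F] {Ω : Type*}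

/-- What is decided by the scheme and by the receptions before slot `n + 1`. -/
abbrev past (R : Fin 2 → ℕ → Ω → Bool) (C : Ω → Scheme F) (n : ℕ) : MeasurableSpace Ω :=
  (⨆ h : List Pattern, MeasurableSpace.comap (fun ω => C ω h) ⊤) ⊔
    ⨆ k : Fin 2 × ℕ, ⨆ _ : k.2 < n, MeasurableSpace.comap (R k.1 k.2) ⊤

/-- What is decided by the receptions in slot `n + 1`. -/
abbrev slot (R : Fin 2 → ℕ → Ω → Bool) (n : ℕ) : MeasurableSpace Ω :=
  ⨆ i : Fin 2, MeasurableSpace.comap (R i n) ⊤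

variable {R : Fin 2 → ℕ → Ω → Bool} {C : Ω → Scheme F}

lemma past_mono {m n : ℕ} (h : m ≤ n) : past R C m ≤ past R C n :=
  sup_le_sup le_rfl (iSup_mono fun _ => iSup_mono' fun hk => ⟨hk.trans_le h, le_rfl⟩)

lemma slot_le_past {m n : ℕ} (h : m < n) : slot R m ≤ past R C n :=
  iSup_le fun i => le_sup_of_le_right (le_iSup₂_of_le (i, m) h le_rfl)

lemma measurable_slot (i : Fin 2) (n : ℕ) : Measurable[slot R n, ⊤] (R i n) :=
  (comap_measurable (m := ⊤) (R i n)).mono (le_iSup (fun i => MeasurableSpace.comap (R i n) ⊤) i)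
    le_rfl

lemma measurable_past_scheme (h : List Pattern) (n : ℕ) :
    Measurable[past R C n, ⊤] fun ω => C ω h :=
  (comap_measurable (m := ⊤) (fun ω => C ω h)).mono
    (le_sup_of_le_left (le_iSup (fun h => MeasurableSpace.comap (fun ω => C ω h) ⊤) h)) le_rfl

lemma measurable_past_pattern {m n : ℕ} (h : m < n) :
    Measurable[past R C n, ⊤] fun ω (i : Fin 2) => R i m ω := by
  have : (fun ω (i : Fin 2) => R i m ω) = fun ω => ![R 0 m ω, R 1 m ω] := by
    funext ω i; fin_cases i <;> rfl
  rw [this]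
  have hi : ∀ i, Measurable[past R C n, ⊤] (R i m) := fun i =>
    (measurable_slot i m).mono (slot_le_past h) le_rfl
  exact measurable_top_comp (measurable_top_prodMk (hi 0) (hi 1)) fun x => ![x.1, x.2]

lemma measurable_past_history {m n : ℕ} (h : m ≤ n) :
    Measurable[past R C n, ⊤] (history R m) := by
  induction m with
  | zero => exact @measurable_const _ _ ⊤ _ []
  | succ m ih =>
    exact measurable_top_comp
      (measurable_top_prodMk (measurable_past_pattern h) (ih (Nat.le_of_succ_le h)))
      fun x => x.1 :: x.2

lemma measurableSet_past_lastOnly (a b : Fin 2) {m n : ℕ} (h : m ≤ n) :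
    MeasurableSet[past R C n] {ω | LastOnly R a b ω m} := by
  induction m with
  | zero => exact @MeasurableSet.empty _ (past R C n)
  | succ m ih =>
    have h1 := measurable_past_pattern (R := R) (C := C) (Nat.lt_of_succ_le h)
    have h2 := measurableSet_of_measurable_top h1 fun x => x a = false
    have h3 := measurableSet_of_measurable_top h1 fun x => x b = true
    exact h2.inter (h3.union (ih (Nat.le_of_succ_le h)))

lemma measurable_past_sent (n : ℕ) : Measurable[past R C n, ⊤] (sent R C n) :=
  measurable_top_eval (f := fun h ω => C ω h) (fun h => measurable_past_scheme h n) (measurable_past_history le_rfl)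

variable [Finite F]

lemma measurable_past_knowledge (h : List Pattern) (i : Fin 2) (n : ℕ) :
    Measurable[past R C n, ⊤] fun ω => knowledge (C ω) h i := by
  induction h with
  | nil => exact @measurable_const _ _ ⊤ _ ⊥
  | cons x h ih =>
    exact measurable_top_comp (measurable_top_prodMk ih (measurable_past_scheme h n))
      fun v => receive v.1 (x i) v.2

lemma measurable_past_knows (i : Fin 2) (n : ℕ) :
    Measurable[past R C n, ⊤] (knows R C i n) :=
  measurable_top_eval (f := fun h ω => knowledge (C ω) h i) (fun h => measurable_past_knowledge h i n) (measurable_past_history le_rfl)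

lemma measurableSet_past_sent_mem (i : Fin 2) (n : ℕ) :
    MeasurableSet[past R C n] {ω | sent R C n ω ∈ knows R C i n ω} :=
  measurableSet_of_measurable_top
    (measurable_top_prodMk (measurable_past_knows i n) (measurable_past_sent n))
    fun x => x.2 ∈ x.1

end Independence

/-! ### Laws of large numbers for the channel -/

section Channel

variable {F : Type*} [Field F] {Ω : Type*} [mΩ : MeasurableSpace Ω] {μ : Measure Ω}
  [IsProbabilityMeasure μ] {p : Fin 2 → ℝ} {R : Fin 2 → ℕ → Ω → Bool} {C : Ω → Scheme F}

lemma IsErasureChannel.slot_le (hR : IsErasureChannel μ p R) (n : ℕ) : slot R n ≤ mΩ :=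
  iSup_le fun i => (hR.measurable i n).comap_le

lemma IsErasureChannel.past_le (hR : IsErasureChannel μ p R) (hC : IsAdmissible μ R C) (n : ℕ) :
    past R C n ≤ mΩ :=
  sup_le (iSup_le fun h => (hC.measurable h).comap_le)
    (iSup₂_le fun k _ => (hR.measurable k.1 k.2).comap_le)

/-- The receptions in a slot are independent of the past. -/
lemma IsErasureChannel.indep_past_slot (hR : IsErasureChannel μ p R) (hC : IsAdmissible μ R C)
    (n : ℕ) : Indep (past R C n) (slot R n) μ := by
  have hi := iIndep_option hC.indep ((iIndepFun_iff_iIndep _ _ _).1 hR.indep)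
  have hle : ∀ o : Option (Fin 2 × ℕ), o.elim
      (⨆ h : List Pattern, MeasurableSpace.comap (fun ω => C ω h) ⊤)
      (fun k => MeasurableSpace.comap (R k.1 k.2) ⊤) ≤ mΩ := by
    rintro (_ | k)
    · exact iSup_le fun h => (hC.measurable h).comap_le
    · exact (hR.measurable k.1 k.2).comap_le
  -- The past consists of `none` and the receptions before slot `n`; these indices are disjoint from
  -- those of the current slot.
  have hd : Disjoint {o : Option (Fin 2 × ℕ) | ∀ k, o = some k → k.2 < n}
      {o | ∃ i, o = some (i, n)} := by
    rw [Set.disjoint_left]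
    rintro _ h1 ⟨i, rfl⟩
    exact lt_irrefl _ (h1 _ rfl)
  refine indep_of_indep_of_le (indep_iSup_of_disjoint hle hi hd) ?_ ?_
  · refine sup_le ?_ (iSup₂_le fun k hk => ?_)
    · refine le_iSup₂_of_le none ?_ le_rfl
      intro k hk
      exact absurd hk (by simp)
    · refine le_iSup₂_of_le (some k) ?_ le_rfl
      rintro _ ⟨⟩
      exact hk
  · exact iSup_le fun i => le_iSup₂_of_le (some (i, n)) ⟨i, rfl⟩ le_rfl

lemma isAdmissible_const (c : Scheme F) : IsAdmissible μ R (fun _ => c) where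
  measurable _ := @measurable_const _ _ ⊤ _ _
  indep := by
    simp only [MeasurableSpace.comap_const, iSup_bot]
    exact indep_bot_left _

lemma IsErasureChannel.integral_mul_eq_zero (hR : IsErasureChannel μ p R)
    (hC : IsAdmissible μ R C) {n : ℕ} {g w : Ω → ℝ} (hg : Measurable[past R C n] g)
    (hw : Measurable[slot R n] w) (h0 : ∫ ω, w ω ∂μ = 0) : ∫ ω, g ω * w ω ∂μ = 0 := by
  have hi : IndepFun g w μ := by
    rw [IndepFun_iff_Indep]
    exact indep_of_indep_of_le (hR.indep_past_slot hC n) hg.comap_le hw.comap_le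
  rw [hi.integral_fun_mul_eq_mul_integral
    (hg.mono (hR.past_le hC n) le_rfl).aestronglyMeasurable
    (hw.mono (hR.slot_le n) le_rfl).aestronglyMeasurable, h0, mul_zero]

/-- Weak law of large numbers for a centered function of the receptions in each slot, weighted
predictably, plus another centered function. -/
lemma IsErasureChannel.weak_law (hR : IsErasureChannel μ p R) (hC : IsAdmissible μ R C)
    {g w : ℕ → Ω → ℝ} (hg : ∀ n, Measurable[past R C n] (g n))
    (hw : ∀ n, Measurable[slot R n] (w n)) (hgb : ∀ n ω, |g n ω| ≤ 1) (hwb : ∀ n ω, |w n ω| ≤ 1)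
    (h0 : ∀ n, ∫ ω, w n ω ∂μ = 0) :
    TendstoInMeasure μ (fun n ω => (∑ k ∈ Finset.range n, g k ω * w k ω) / n) atTop
      fun _ => 0 := by
  refine weak_law_of_orthogonal (f := fun k ω => g k ω * w k ω) (fun k => ?_) (fun k ω => ?_) ?_
  · exact ((hg k).mono (hR.past_le hC k) le_rfl).mul ((hw k).mono (hR.slot_le k) le_rfl)
  · rw [abs_mul]
    exact mul_le_one₀ (hgb k ω) (abs_nonneg _) (hwb k ω)
  · intro j k hjk
    have e : ∀ ω, g j ω * w j ω * (g k ω * w k ω) = (g j ω * w j ω * g k ω) * w k ω :=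
      fun ω => by ring
    simp only [e]
    -- The first three factors belong to the past of slot `k`, while `w k` is centered and
    -- independent of it.
    refine hR.integral_mul_eq_zero hC ?_ (hw k) (h0 k)
    exact (((hg j).mono (past_mono hjk.le) le_rfl).mul
      ((hw j).mono (slot_le_past hjk) le_rfl)).mul (hg k)

variable (R) in
/-- The indicator of a reception, as a real number. -/
def arrival (i : Fin 2) (n : ℕ) (ω : Ω) : ℝ := if R i n ω = true then 1 else 0

lemma arrival_nonneg (i : Fin 2) (n : ℕ) (ω : Ω) : 0 ≤ arrival R i n ω := by
  unfold arrival; split_ifs <;> norm_num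

lemma arrival_le_one (i : Fin 2) (n : ℕ) (ω : Ω) : arrival R i n ω ≤ 1 := by
  unfold arrival; split_ifs <;> norm_num

lemma measurable_arrival (i : Fin 2) (n : ℕ) : Measurable[slot R n] (arrival R i n) :=
  fun _ _ => measurable_top_comp (measurable_slot i n)
    (fun x : Bool => if x = true then (1 : ℝ) else 0) trivial

lemma sum_arrival (i : Fin 2) (n : ℕ) (ω : Ω) :
    ∑ k ∈ Finset.range n, arrival R i k ω = received R i n ω := by
  simp [arrival, received]

lemma IsErasureChannel.integrable_arrival (hR : IsErasureChannel μ p R) (i : Fin 2) (n : ℕ) :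
    Integrable (arrival R i n) μ :=
  integrable_of_abs_le ((measurable_arrival i n).mono (hR.slot_le n) le_rfl) (c := 1) fun ω => by
    rw [abs_of_nonneg (arrival_nonneg i n ω)]; exact arrival_le_one i n ω

lemma IsErasureChannel.integral_arrival (hR : IsErasureChannel μ p R) (i : Fin 2) (n : ℕ) :
    ∫ ω, arrival R i n ω ∂μ = p i := by
  have hm : MeasurableSet {ω | R i n ω = true} := hR.measurable i n (measurableSet_singleton true)
  have e : arrival R i n = Set.indicator {ω | R i n ω = true} 1 := by
    funext ω; simp [arrival, Set.indicator_apply]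
  rw [e, integral_indicator_one hm, hR.prob]

lemma IsErasureChannel.indepFun_arrival (hR : IsErasureChannel μ p R) {i j : Fin 2} {m n : ℕ}
    (h : (i, m) ≠ (j, n)) : IndepFun (arrival R i m) (arrival R j n) μ :=
  (hR.indep.indepFun h).comp (φ := fun x : Bool => if x = true then (1 : ℝ) else 0)
    (ψ := fun x : Bool => if x = true then (1 : ℝ) else 0)
    (measurable_of_countable _) (measurable_of_countable _)

lemma IsErasureChannel.integral_arrival_mul (hR : IsErasureChannel μ p R) {a b : Fin 2}
    (hab : a ≠ b) (n : ℕ) : ∫ ω, arrival R a n ω * arrival R b n ω ∂μ = p a * p b := by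
  rw [(hR.indepFun_arrival (by simp [hab])).integral_fun_mul_eq_mul_integral
    (hR.integrable_arrival a n).1 (hR.integrable_arrival b n).1, hR.integral_arrival,
    hR.integral_arrival]

/-- Strong law of large numbers for the receptions. -/
lemma IsErasureChannel.strong_law (hR : IsErasureChannel μ p R) (i : Fin 2) :
    ∀ᵐ ω ∂μ, Tendsto (fun n : ℕ => (received R i n ω : ℝ) / n) atTop (nhds (p i)) := by
  have hident : ∀ n, IdentDistrib (arrival R i n) (arrival R i 0) μ μ := by
    intro n
    have hB : IdentDistrib (R i n) (R i 0) μ μ := by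
      refine ⟨(hR.measurable i n).aemeasurable, (hR.measurable i 0).aemeasurable, ?_⟩
      have h1 : ∀ n, (μ.map (R i n)) {true} = ENNReal.ofReal (p i) := fun n => by
        rw [Measure.map_apply (hR.measurable i n) (measurableSet_singleton _), ← hR.prob i n,
          ofReal_measureReal]
        rfl
      have h2 : ∀ n, (μ.map (R i n)) {false} = 1 - ENNReal.ofReal (p i) := fun n => by
        have := Measure.isProbabilityMeasure_map (μ := μ) (hR.measurable i n).aemeasurable
        rw [← h1 n, ← prob_compl_eq_one_sub (measurableSet_singleton _)]
        congr 1
        ext x; cases x <;> simp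
      refine Measure.ext_of_singleton fun x => ?_
      cases x
      · rw [h2, h2]
      · rw [h1, h1]
    exact hB.comp (u := fun x : Bool => if x = true then (1 : ℝ) else 0)
      (measurable_of_countable _)
  have h := strong_law_ae_real (arrival R i) (hR.integrable_arrival i 0)
    (fun m n hmn => hR.indepFun_arrival (by simp [hmn])) hident
  rw [hR.integral_arrival] at h
  simpa only [sum_arrival] using h

lemma IsErasureChannel.nonneg (hR : IsErasureChannel μ p R) (i : Fin 2) : 0 ≤ p i := by
  rw [← hR.prob i 0]; exact measureReal_nonneg

lemma IsErasureChannel.le_one (hR : IsErasureChannel μ p R) (i : Fin 2) : p i ≤ 1 := by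
  rw [← hR.prob i 0]; exact measureReal_le_one

lemma slots_eq_sum (P : ℕ → Prop) [DecidablePred P] (n : ℕ) :
    (slots P n : ℝ) = ∑ k ∈ Finset.range n, if P k then 1 else 0 := by
  simp [slots_eq_card]

lemma measurable_slots {P : ℕ → Ω → Prop} (hP : ∀ k, MeasurableSet {ω | P k ω}) (n : ℕ) :
    Measurable fun ω => (slots (fun k => P k ω) n : ℝ) := by
  classical
  simp only [slots_eq_sum]
  exact Finset.measurable_fun_sum _ fun k _ =>
    Measurable.ite (hP k) measurable_const measurable_const

/-- The long-run frequency of the slots in which `b` receives and the last slot before it that was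
not erased for both users was received by `b` only. -/
noncomputable def lagRate (p : Fin 2 → ℝ) (a b : Fin 2) : ℝ :=
  p b * (p b * (1 - p a)) / (p a + p b - p a * p b)

/-- Telescoping: the state is replaced by `(1 - A) * B` exactly when `A + B - A * B = 1`, that is,
when the slot is not erased for both users. -/
lemma lastOnly_sum_identity (a b : Fin 2) (ω : Ω) [DecidablePred (LastOnly R a b ω)] (n : ℕ) :
    (if LastOnly R a b ω n then (1 : ℝ) else 0) =
      ∑ k ∈ Finset.range n, ((1 - arrival R a k ω) * arrival R b k ω -
        (if LastOnly R a b ω k then 1 else 0) *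
          (arrival R a k ω + arrival R b k ω - arrival R a k ω * arrival R b k ω)) := by
  induction n with
  | zero => simp [LastOnly]
  | succ n ih =>
    rw [Finset.sum_range_succ, ← ih]
    have h : LastOnly R a b ω (n + 1) ↔ R a n ω = false ∧ (R b n ω = true ∨ LastOnly R a b ω n) :=
      Iff.rfl
    simp only [h, arrival]
    by_cases h1 : R a n ω = true <;> by_cases h2 : R b n ω = true <;>
      by_cases h3 : LastOnly R a b ω n <;> simp [h1, h2, h3]

/-- Write `z` for the indicator of `LastOnly` and `c` for that of a slot not erased for both users.
Since `z` is bounded, the telescoping identity gives `z * c` the average `(1 - p a) * p b`. As `z`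
is predictable, the averages of `z * B` and `z * c` are in the ratio `p b : q` of the means of `B`
and `c`. -/
lemma IsErasureChannel.lastOnly_law (hR : IsErasureChannel μ p R) {a b : Fin 2} (hab : a ≠ b)
    (hpa : 0 < p a) : TendstoInMeasure μ
      (fun n ω => (slots (fun k => LastOnly R a b ω k ∧ R b k ω = true) n : ℝ) / n) atTop
      fun _ => lagRate p a b := by
  classical
  set q := p a + p b - p a * p b with hq
  have ha1 := hR.le_one a
  have hb1 := hR.le_one b
  have hb0 := hR.nonneg b
  have hq0 : 0 < q := by rw [hq]; nlinarith
  have hq1 : q ≤ 1 := by rw [hq]; nlinarith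
  set z : ℕ → Ω → ℝ := fun k ω => if LastOnly R a b ω k then 1 else 0 with hz
  set A := arrival R a with hA
  set B := arrival R b with hB
  have hA0 : ∀ k ω, 0 ≤ A k ω := arrival_nonneg a
  have hA1 : ∀ k ω, A k ω ≤ 1 := arrival_le_one a
  have hB0 : ∀ k ω, 0 ≤ B k ω := arrival_nonneg b
  have hB1 : ∀ k ω, B k ω ≤ 1 := arrival_le_one b
  have hAm : ∀ k, Measurable[slot R k] (A k) := measurable_arrival a
  have hBm : ∀ k, Measurable[slot R k] (B k) := measurable_arrival b
  have iA : ∀ k, Integrable (A k) μ := hR.integrable_arrival a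
  have iB : ∀ k, Integrable (B k) μ := hR.integrable_arrival b
  have iAB : ∀ k, Integrable (fun ω => A k ω * B k ω) μ := fun k =>
    (hR.indepFun_arrival (by simp [hab])).integrable_mul (iA k) (iB k)
  have eA : ∀ k, ∫ ω, A k ω ∂μ = p a := hR.integral_arrival a
  have eB : ∀ k, ∫ ω, B k ω ∂μ = p b := hR.integral_arrival b
  have eAB : ∀ k, ∫ ω, A k ω * B k ω ∂μ = p a * p b := hR.integral_arrival_mul hab
  set c : ℕ → Ω → ℝ := fun k ω => A k ω + B k ω - A k ω * B k ω with hc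
  have hc0 : ∀ k ω, 0 ≤ c k ω := fun k ω => by
    have := hA0 k ω; have := hA1 k ω; have := hB0 k ω; simp only [hc]; nlinarith
  have hc1 : ∀ k ω, c k ω ≤ 1 := fun k ω => by
    have := hA1 k ω; have := hB1 k ω; simp only [hc]; nlinarith
  have hcm : ∀ k, Measurable[slot R k] (c k) := fun k =>
    ((hAm k).add (hBm k)).sub ((hAm k).mul (hBm k))
  have ic : ∀ k, Integrable (c k) μ := fun k => ((iA k).add (iB k)).sub (iAB k)
  have ec : ∀ k, ∫ ω, c k ω ∂μ = q := fun k => by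
    have i1 : Integrable (fun ω => A k ω + B k ω) μ := (iA k).add (iB k)
    simp only [hc]
    rw [integral_sub i1 (iAB k), integral_add (iA k) (iB k), eA, eB, eAB]
  have hzm : ∀ k, Measurable[past R (fun _ => greedy ℚ) k] (z k) := fun k =>
    Measurable.ite (measurableSet_past_lastOnly a b le_rfl) measurable_const measurable_const
  have hzb : ∀ k ω, |z k ω| ≤ 1 := fun k ω => by
    simp only [hz]; split_ifs <;> norm_num
  -- The combination `q * B - p b * c` has mean zero because `B` has mean `p b` and `c` has mean
  -- `q`.
  have law1 := hR.weak_law (isAdmissible_const (greedy ℚ)) (g := z)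
    (w := fun k ω => q * B k ω - p b * c k ω) hzm
    (fun k => ((hBm k).const_mul q).sub ((hcm k).const_mul (p b))) hzb
    (fun k ω => by
      rw [abs_le]
      have := hB0 k ω; have := hB1 k ω; have := hc0 k ω; have := hc1 k ω
      constructor <;> nlinarith)
    (fun k => by
      rw [integral_sub ((iB k).const_mul q) ((ic k).const_mul (p b)), integral_const_mul,
        integral_const_mul, eB, ec]
      ring)
  have law2 := hR.weak_law (isAdmissible_const (greedy ℚ)) (g := fun _ _ => 1)
    (w := fun k ω => (1 - A k ω) * B k ω - (1 - p a) * p b) (fun _ => measurable_const)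
    (fun k => ((measurable_const.sub (hAm k)).mul (hBm k)).sub measurable_const)
    (fun _ _ => by simp)
    (fun k ω => by
      rw [abs_le]
      have h1 : 0 ≤ (1 - A k ω) * B k ω := mul_nonneg (by linarith [hA1 k ω]) (hB0 k ω)
      have h2 : (1 - A k ω) * B k ω ≤ 1 :=
        mul_le_one₀ (by linarith [hA0 k ω]) (hB0 k ω) (hB1 k ω)
      have h3 : 0 ≤ (1 - p a) * p b := mul_nonneg (by linarith) hb0
      have h4 : (1 - p a) * p b ≤ 1 := mul_le_one₀ (by linarith) hb0 hb1
      constructor <;> linarith)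
    (fun k => by
      have e : ∀ ω, (1 - A k ω) * B k ω - (1 - p a) * p b =
        B k ω - A k ω * B k ω - (1 - p a) * p b := fun ω => by ring
      simp only [e]
      have i1 : Integrable (fun ω => B k ω - A k ω * B k ω) μ := (iB k).sub (iAB k)
      rw [integral_sub i1 (integrable_const _), integral_sub (iB k) (iAB k), eB, eAB]
      simp
      ring)
  have hdet : Tendsto (fun n : ℕ => (1 : ℝ) / n) atTop (nhds 0) :=
    tendsto_const_div_atTop_nhds_zero_nat 1
  have law3 : TendstoInMeasure μ
      (fun (n : ℕ) ω => (∑ k ∈ Finset.range n, z k ω * c k ω) / n - (1 - p a) * p b) atTop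
      fun _ => 0 := by
    refine tendstoInMeasure_of_abs_sub_le one_pos law2 (tendstoInMeasure_of_tendsto hdet) ?_
    filter_upwards [eventually_gt_atTop 0] with n hn ω
    have hn' : (n : ℝ) ≠ 0 := by exact_mod_cast hn.ne'
    have hzn : z n ω = ∑ k ∈ Finset.range n, ((1 - A k ω) * B k ω - z k ω * c k ω) :=
      lastOnly_sum_identity a b ω n
    have e : (∑ k ∈ Finset.range n, z k ω * c k ω) / n - (1 - p a) * p b - 0 =
        (∑ k ∈ Finset.range n, 1 * ((1 - A k ω) * B k ω - (1 - p a) * p b)) / n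
          + -(z n ω * (1 / n)) := by
      rw [hzn]
      simp only [one_mul, Finset.sum_sub_distrib, Finset.sum_const, Finset.card_range,
        nsmul_eq_mul]
      field_simp
      ring
    rw [e, one_mul]
    refine (abs_add_le _ _).trans (add_le_add le_rfl ?_)
    rw [abs_neg, abs_mul]
    exact mul_le_of_le_one_left (abs_nonneg _) (hzb n ω)
  refine tendstoInMeasure_of_abs_sub_le (inv_pos.2 hq0) law1 law3 ?_
  filter_upwards [eventually_gt_atTop 0] with n hn ω
  have hn' : (n : ℝ) ≠ 0 := by exact_mod_cast hn.ne'
  have hG : (slots (fun k => LastOnly R a b ω k ∧ R b k ω = true) n : ℝ) =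
      ∑ k ∈ Finset.range n, z k ω * B k ω := by
    rw [slots_eq_sum]
    refine Finset.sum_congr rfl fun k _ => ?_
    simp only [hz, hB, arrival]
    by_cases h1 : R b k ω = true <;> by_cases h2 : LastOnly R a b ω k <;> simp [h1, h2]
  have e : (slots (fun k => LastOnly R a b ω k ∧ R b k ω = true) n : ℝ) / n - lagRate p a b =
      q⁻¹ * ((∑ k ∈ Finset.range n, z k ω * (q * B k ω - p b * c k ω)) / n +
        p b * ((∑ k ∈ Finset.range n, z k ω * c k ω) / n - (1 - p a) * p b)) := by
    have e1 : ∑ k ∈ Finset.range n, z k ω * (q * B k ω - p b * c k ω) =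
        q * (∑ k ∈ Finset.range n, z k ω * B k ω) -
          p b * ∑ k ∈ Finset.range n, z k ω * c k ω := by
      rw [Finset.mul_sum, Finset.mul_sum, ← Finset.sum_sub_distrib]
      exact Finset.sum_congr rfl fun k _ => by ring
    rw [hG, e1, lagRate, ← hq]
    field_simp
    ring
  rw [e, abs_mul, abs_of_pos (inv_pos.2 hq0)]
  refine mul_le_mul_of_nonneg_left ((abs_add_le _ _).trans (add_le_add le_rfl ?_))
    (inv_pos.2 hq0).le
  rw [abs_mul, abs_of_nonneg hb0]
  exact mul_le_of_le_one_left (abs_nonneg _) hb1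

end Channel

/-! ### Smoothness of greedy and the bounds for competing schemes -/

section Optimality

variable {F : Type*} [Field F] {Ω : Type*} [mΩ : MeasurableSpace Ω] {μ : Measure Ω}
  [IsProbabilityMeasure μ] {p : Fin 2 → ℝ} {R : Fin 2 → ℕ → Ω → Bool} {C : Ω → Scheme F}
  {a b : Fin 2}

lemma tendstoInMeasure_sub_const {f : ℕ → Ω → ℝ} {c : ℝ}
    (h : TendstoInMeasure μ f atTop fun _ => c) :
    TendstoInMeasure μ (fun n ω => f n ω - c) atTop fun _ => 0 := by
  rw [tendstoInMeasure_iff_measureReal_norm] at *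
  simpa only [sub_zero] using h

lemma throughputOptimal_greedy (F : Type*) [Field F] :
    ThroughputOptimal μ R (fun _ => greedy F) := by
  intro i
  unfold HasThroughputLoss
  simp only [redundant_greedy, Nat.cast_zero, zero_div]
  exact tendstoInMeasure_of_tendsto tendsto_const_nhds

section Greedy

variable [Finite F]

lemma measurableSet_past_not_regular (k : ℕ) :
    MeasurableSet[past R C k] {ω | ¬ Regular R C a b ω k} := by
  have hr : ∀ i, Measurable[past R C k, ⊤] (requiredAt R C i k) := fun i =>
    measurable_top_comp (measurable_past_knows i k) required
  have h1 := measurableSet_of_measurable_top (measurable_top_prodMk (hr b) (hr a))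
    fun x => x.1 < x.2
  exact (h1.inter (measurableSet_past_sent_mem a k).compl).compl

lemma IsErasureChannel.irregular_law (hR : IsErasureChannel μ p R) (hab : a ≠ b)
    (hp : p b < p a) : TendstoInMeasure μ
      (fun n ω => (slots (fun k => ¬ Regular R (fun _ => greedy F) a b ω k) n : ℝ) / n) atTop
      fun _ => 0 := by
  refine tendstoInMeasure_of_tendsto_ae (fun n => ?_) ?_
  · exact ((measurable_slots (fun k => hR.past_le (isAdmissible_const _) k _
      (measurableSet_past_not_regular k)) n).div_const _).aestronglyMeasurable
  · filter_upwards [hR.strong_law 0, hR.strong_law 1] with ω h0 h1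
    obtain ⟨K, c, hK⟩ := exists_slots_not_regular_le (F := F) hab hp
      (Fin.forall_of_ne (a := 0) (b := 1) (by decide) h0 h1)
    have hs : ∀ n, slots (fun k => sent R (fun _ => greedy F) k ω ∈
        knows R (fun _ => greedy F) a k ω) n = 0 := fun n => by
      classical
      rw [slots_eq_card, Finset.card_eq_zero, Finset.filter_eq_empty_iff]
      exact fun k _ => greedy_innovative _ a
    -- Greedy has no redundant receptions and no transmission that is not innovative for `a`, so on
    -- this path the number of irregular slots stays bounded.
    have hb : ∀ n, (slots (fun k => ¬ Regular R (fun _ => greedy F) a b ω k) n : ℝ) ≤ K :=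
      fun n => by
        simpa [redundant_greedy, hs] using hK (fun _ => greedy F) (usesRequiredPackets_greedy F) n
    refine squeeze_zero (fun n => by positivity) (fun n => ?_)
      (tendsto_const_div_atTop_nhds_zero_nat K)
    exact div_le_div_of_nonneg_right (hb n) (Nat.cast_nonneg n)

lemma IsErasureChannel.smoothness_greedy_leader (hR : IsErasureChannel μ p R) (hab : a ≠ b)
    (hp : p b < p a) : HasSmoothnessIndex μ R (fun _ => greedy F) a (p a) := by
  have hX : TendstoInMeasure μ (fun n ω => (received R a n ω : ℝ) / n) atTop fun _ => p a := by
    refine tendstoInMeasure_of_tendsto_ae (fun n => ?_) (hR.strong_law a)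
    simp only [← sum_arrival]
    exact ((Finset.measurable_fun_sum _ fun k _ => (measurable_arrival a k).mono (hR.slot_le k)
      le_rfl).div_const _).aestronglyMeasurable
  refine tendstoInMeasure_of_abs_sub_le one_pos (tendstoInMeasure_sub_const hX)
    (hR.irregular_law (F := F) hab hp) (Eventually.of_forall fun n ω => ?_)
  have h1 : (bursts R (fun _ => greedy F) a n ω : ℝ) / n ≤ (received R a n ω : ℝ) / n :=
    div_le_div_of_nonneg_right (Nat.cast_le.2 (bursts_le_received a n)) (Nat.cast_nonneg n)
  have h2 : (received R a n ω : ℝ) / n ≤ (bursts R (fun _ => greedy F) a n ω : ℝ) / n +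
      (slots (fun k => ¬ Regular R (fun _ => greedy F) a b ω k) n : ℝ) / n := by
    rw [← add_div]
    exact div_le_div_of_nonneg_right (by
      exact_mod_cast received_le_bursts_greedy (F := F) (R := R) (ω := ω) hab n)
      (Nat.cast_nonneg n)
  have h3 := le_abs_self ((slots (fun k => ¬ Regular R (fun _ => greedy F) a b ω k) n : ℝ) / n)
  have h4 := abs_le.1 (le_refl |(received R a n ω : ℝ) / n - p a|)
  rw [one_mul, abs_le]
  constructor <;> linarith [h4.1, h4.2,
    abs_nonneg ((slots (fun k => ¬ Regular R (fun _ => greedy F) a b ω k) n : ℝ) / n)]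

lemma IsErasureChannel.smoothness_greedy_lagger (hR : IsErasureChannel μ p R) (hab : a ≠ b)
    (hp : p b < p a) : HasSmoothnessIndex μ R (fun _ => greedy F) b (lagRate p a b) := by
  have hG := hR.lastOnly_law hab ((hR.nonneg b).trans_lt hp)
  refine tendstoInMeasure_of_abs_sub_le two_pos (tendstoInMeasure_sub_const hG)
    (hR.irregular_law (F := F) hab hp) (Eventually.of_forall fun n ω => ?_)
  set G : ℝ := (slots (fun k => LastOnly R a b ω k ∧ R b k ω = true) n : ℝ) / n with hGd
  set B : ℝ := (slots (fun k => ¬ Regular R (fun _ => greedy F) a b ω k) n : ℝ) / n with hBd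
  have h1 : (bursts R (fun _ => greedy F) b n ω : ℝ) / n ≤ G + 2 * B := by
    rw [hGd, hBd, ← mul_div_assoc, ← add_div]
    exact div_le_div_of_nonneg_right (by
      exact_mod_cast bursts_le_slots (R := R) (ω := ω) (C := fun _ => greedy F)
        (usesRequiredPackets_greedy F) hab n)
      (Nat.cast_nonneg n)
  have h2 : G ≤ (bursts R (fun _ => greedy F) b n ω : ℝ) / n + 2 * B := by
    rw [hGd, hBd, ← mul_div_assoc, ← add_div]
    exact div_le_div_of_nonneg_right (by
      exact_mod_cast slots_le_bursts_greedy (F := F) (R := R) (ω := ω) hab n)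
      (Nat.cast_nonneg n)
  have h3 := le_abs_self B
  have h4 := abs_le.1 (le_refl |G - lagRate p a b|)
  rw [abs_le]
  constructor <;> linarith [h4.1, h4.2, abs_nonneg B, abs_nonneg (G - lagRate p a b)]

end Greedy

/-- Real-valued sequences that converge in measure converge along a common subsequence at a common
point of any almost sure event. -/
lemma exists_common_subseq {ι : Type*} (l : List ι) {f : ι → ℕ → Ω → ℝ} {c : ι → ℝ}
    (hf : ∀ i ∈ l, TendstoInMeasure μ (f i) atTop fun _ => c i) :
    ∃ ns : ℕ → ℕ, StrictMono ns ∧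
      ∀ᵐ ω ∂μ, ∀ i ∈ l, Tendsto (fun n => f i (ns n) ω) atTop (nhds (c i)) := by
  induction l with
  | nil => exact ⟨id, strictMono_id, by simp⟩
  | cons i l ih =>
    obtain ⟨ns, hns, h⟩ := ih fun j hj => hf j (List.mem_cons_of_mem _ hj)
    obtain ⟨ms, hms, h'⟩ :=
      ((hf i List.mem_cons_self).comp hns.tendsto_atTop).exists_seq_tendsto_ae
    refine ⟨ns ∘ ms, hns.comp hms, ?_⟩
    filter_upwards [h, h'] with ω h1 h2 j hj
    rcases List.mem_cons.1 hj with rfl | hj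
    · exact h2
    · exact (h1 j hj).comp hms.tendsto_atTop

lemma IsErasureChannel.smoothness_le (hR : IsErasureChannel μ p R) {i : Fin 2} {s : ℝ}
    (hs : HasSmoothnessIndex μ R C i s) : s ≤ p i := by
  obtain ⟨ns, hns, h⟩ := hs.exists_seq_tendsto_ae
  obtain ⟨ω, h1, h2⟩ := (h.and (hR.strong_law i)).exists
  refine le_of_tendsto_of_tendsto' h1 (h2.comp hns.tendsto_atTop) fun n => ?_
  exact div_le_div_of_nonneg_right (Nat.cast_le.2 (bursts_le_received i _)) (Nat.cast_nonneg _)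

/-- The slots with a transmission that is not innovative for `a` are, up to a vanishing fraction,
`(p a)⁻¹` times as frequent as those in which `a` receives it. -/
lemma IsErasureChannel.redundant_law [Finite F] (hR : IsErasureChannel μ p R)
    (hC : IsAdmissible μ R C) (a : Fin 2) : TendstoInMeasure μ
      (fun n ω => (redundant R C a n ω : ℝ) / n -
        p a * ((slots (fun k => sent R C k ω ∈ knows R C a k ω) n : ℝ) / n)) atTop
      fun _ => 0 := by
  classical
  -- Whether the transmission is innovative is decided before the slot, and the reception minus `p
  -- a` is centered.
  have h := hR.weak_law hC (g := fun k ω => if sent R C k ω ∈ knows R C a k ω then 1 else 0)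
    (w := fun k ω => arrival R a k ω - p a)
    (fun k => Measurable.ite (measurableSet_past_sent_mem a k) measurable_const measurable_const)
    (fun k => (measurable_arrival a k).sub measurable_const)
    (fun k ω => by split_ifs <;> norm_num)
    (fun k ω => by
      rw [abs_le]
      have := arrival_nonneg (R := R) a k ω
      have := arrival_le_one (R := R) a k ω
      have := hR.nonneg a
      have := hR.le_one a
      constructor <;> linarith)
    (fun k => by
      rw [integral_sub (hR.integrable_arrival a k) (integrable_const _), hR.integral_arrival]
      simp)
  convert h using 3 with n ω
  rw [redundant_eq_slots, slots_eq_sum, slots_eq_sum, ← mul_div_assoc, ← sub_div, Finset.mul_sum,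
    ← Finset.sum_sub_distrib]
  congr 1
  refine Finset.sum_congr rfl fun k _ => ?_
  unfold arrival
  by_cases h1 : R a k ω = true <;> by_cases h2 : sent R C k ω ∈ knows R C a k ω <;>
    simp [h1, h2]

/-- The path bound has constants depending on `ω`. Along a common subsequence all quantities
converge almost surely, so one path in that event and in the strong-law events suffices. -/
lemma IsErasureChannel.smoothness_lagger_le [Finite F] (hR : IsErasureChannel μ p R)
    (hab : a ≠ b) (hp : p b < p a) (hC : IsAdmissible μ R C) (hU : ∀ ω, UsesRequiredPackets (C ω))
    (ha : HasThroughputLoss μ R C a 0) {s : ℝ} (hs : HasSmoothnessIndex μ R C b s) :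
    s ≤ lagRate p a b := by
  have hpa : 0 < p a := (hR.nonneg b).trans_lt hp
  set N : ℕ → Ω → ℝ := fun n ω => slots (fun k => sent R C k ω ∈ knows R C a k ω) n with hN
  set G : ℕ → Ω → ℝ := fun n ω => slots (fun k => LastOnly R a b ω k ∧ R b k ω = true) n with hG
  obtain ⟨ns, hns, h⟩ := exists_common_subseq (μ := μ) (List.finRange 4)
    (f := ![fun n ω => (bursts R C b n ω : ℝ) / n,
      fun n ω => (redundant R C a n ω : ℝ) / received R a n ω,
      fun n ω => G n ω / n,
      fun n ω => (redundant R C a n ω : ℝ) / n - p a * (N n ω / n)])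
    (c := ![s, 0, lagRate p a b, 0]) (by
      intro i _
      fin_cases i
      · exact hs
      · exact ha
      · exact hR.lastOnly_law hab hpa
      · exact hR.redundant_law hC a)
  obtain ⟨ω, hω, h0, h1⟩ := (h.and ((hR.strong_law 0).and (hR.strong_law 1))).exists
  have hb := hω 0 (List.mem_finRange _)
  have hY := hω 1 (List.mem_finRange _)
  have hGl := hω 2 (List.mem_finRange _)
  have hNl := hω 3 (List.mem_finRange _)
  simp only [Matrix.cons_val] at hb hY hGl hNl
  obtain ⟨K, c, hK⟩ := exists_slots_not_regular_le (F := F) hab hp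
    (Fin.forall_of_ne (a := 0) (b := 1) (by decide) h0 h1)
  have hY' : Tendsto (fun n => (redundant R C a (ns n) ω : ℝ) / (ns n : ℕ)) atTop (nhds 0) := by
    refine squeeze_zero (fun n => by positivity) (fun n => ?_) hY
    -- The loss divides by receptions instead of slots, which only enlarges the ratio. With no
    -- receptions the quotient is 0 by convention, and the redundant count is 0 too.
    rcases Nat.eq_zero_or_pos (received R a (ns n) ω) with hz | hz
    · have : redundant R C a (ns n) ω = 0 :=
        Nat.le_zero.1 (hz ▸ redundant_le_received a (ns n))
      simp [this]
    · exact div_le_div_of_nonneg_left (Nat.cast_nonneg _) (by exact_mod_cast hz)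
        (Nat.cast_le.2 (received_le a (ns n)))
  have hN' : Tendsto (fun n => N (ns n) ω / (ns n : ℕ)) atTop (nhds 0) := by
    have := (hY'.sub hNl).const_mul (p a)⁻¹
    simp only [sub_sub_cancel, sub_zero, mul_zero, inv_mul_cancel_left₀ hpa.ne'] at this
    exact this
  have hKl : Tendsto (fun n => K / (ns n : ℕ)) atTop (nhds 0) :=
    (tendsto_const_div_atTop_nhds_zero_nat K).comp hns.tendsto_atTop
  -- The irregular slots are bounded by `K`, the redundant receptions and the non-innovative slots;
  -- each is negligible relative to `ns n`, so only `lagRate` remains in the limit.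
  have hbound := hGl.add (((hKl.add (hY'.const_mul c)).add hN').const_mul 2)
  simp only [mul_zero, add_zero] at hbound
  refine le_of_tendsto_of_tendsto' hb hbound fun n => ?_
  have h1 : (bursts R C b (ns n) ω : ℝ) ≤
      G (ns n) ω + 2 * slots (fun k => ¬ Regular R C a b ω k) (ns n) := by
    simp only [hG]
    exact_mod_cast bursts_le_slots (R := R) (hU ω) hab (ns n)
  have h2 := hK C (hU ω) (ns n)
  rw [← mul_div_assoc, ← add_div, ← add_div, ← mul_div_assoc, ← add_div]
  exact div_le_div_of_nonneg_right (by linarith) (Nat.cast_nonneg _)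

end Optimality

end InOrder

/-! ### The main theorem -/

theorem claim4 (F : Type*) [Field F] [Finite F]
    {Ω : Type*} [MeasurableSpace Ω] (μ : Measure Ω) [IsProbabilityMeasure μ]
    (p : Fin 2 → ℝ) (hp_pos : ∀ i, 0 < p i) (hp_le : ∀ i, p i ≤ 1)
    (R : Fin 2 → ℕ → Ω → Bool) (hR : InOrder.IsErasureChannel μ p R) :
    InOrder.UsesRequiredPackets (InOrder.greedy F) ∧
    InOrder.ThroughputOptimal μ R (fun _ => InOrder.greedy F) ∧
    (p 0 ≠ p 1 →
      ∃ s : Fin 2 → ℝ,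
        (∀ i, InOrder.HasSmoothnessIndex μ R (fun _ => InOrder.greedy F) i (s i)) ∧
        ∀ C : Ω → InOrder.Scheme F,
          InOrder.IsAdmissible μ R C →
          (∀ ω, InOrder.UsesRequiredPackets (C ω)) →
          InOrder.ThroughputOptimal μ R C →
          ∀ (i : Fin 2) (s' : ℝ), InOrder.HasSmoothnessIndex μ R C i s' → s' ≤ s i) := by
  refine ⟨InOrder.usesRequiredPackets_greedy F, InOrder.throughputOptimal_greedy F, fun hne => ?_⟩
  -- The user `a` with the better channel is the long-run leader under greedy; its index is `p a`,
  -- and that of `b` is `lagRate p a b`.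
  obtain ⟨a, b, hab, hp⟩ : ∃ a b : Fin 2, a ≠ b ∧ p b < p a := by
    rcases hne.lt_or_gt with h | h
    · exact ⟨1, 0, by decide, h⟩
    · exact ⟨0, 1, by decide, h⟩
  have hsa : ∀ x y : ℝ, (Function.update (fun _ => y) a x : Fin 2 → ℝ) a = x := fun x y =>
    Function.update_self _ _ _
  have hsb : ∀ x y : ℝ, (Function.update (fun _ => y) a x : Fin 2 → ℝ) b = y := fun x y =>
    Function.update_of_ne hab.symm _ _
  refine ⟨Function.update (fun _ => InOrder.lagRate p a b) a (p a), ?_, fun C hC hU hT => ?_⟩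
  · refine InOrder.Fin.forall_of_ne hab ?_ ?_
    · rw [hsa]; exact hR.smoothness_greedy_leader hab hp
    · rw [hsb]; exact hR.smoothness_greedy_lagger hab hp
  · refine InOrder.Fin.forall_of_ne hab (fun s' hs' => ?_) (fun s' hs' => ?_)
    · rw [hsa]; exact hR.smoothness_le hs'
    · rw [hsb]; exact hR.smoothness_lagger_le hab hp hC hU (hT a) hs'
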